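/- Let $\mathcal G=(\mathcal V,\mathcal E)$ be an infinite tree (between any two vertices there is exactly one path) with edge lengths $\ell(e)>0$, and let $1\le p<\infty$ be such that $\sum_{e\in\mathcal E}\ell(e)^p<\infty$. Fix a vertex $u$. For a vertex $w$ put $T_u(w)=\sum_{j}\ell(e_j)\delta_{e_j}\in\ell^p(\mathcal E)$, where $e_1,\dots,e_k$ are the edges of the path from $u$ to $w$ and $\delta_e$ are the canonical unit vectors; for an edge $e$ whose end nearest to $u$ is $w$, put $e_u(t)=T_u(w)+t\,\delta_e$ for $0\le t\le\ell(e)$. Let $\mathcal P\subset\ell^p(\mathcal E)$ be the set of all points $e_u(t)$ and let $\mathcal T$ be the closure of $\mathcal P$ (the $p$-parameterization of $\mathcal G$). For $\alpha>0$ let $H_\alpha=L^2([-\alpha,\alpha],\mathfrak m/2\alpha)$, with $\mathfrak m$ Lebesgue measure, and let $D_\alpha$ be the self-adjoint operator on $H_\alpha$ with $D_\alpha e_k=(\pi k/\alpha)e_k$ for the orthonormal basis $e_k(x)=\exp(i\pi kx/\alpha)$, $k\in\mathbb Z$. For each edge $e$, let $f\in C(\mathcal T)$ act on $H_{\ell(e)}$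 as multiplication by the function $t\mapsto f(e_u(|t|))$. Let $H_{\mathcal G}=\bigoplus_{e\in\mathcal E}H_{\ell(e)}$ be the Hilbert space direct sum, $\pi$ the direct sum of these representations of $C(\mathcal T)$, and $$D_{\mathcal G}=\bigoplus_{e\in\mathcal E}\Bigl(D_{\ell(e)}+\frac{\pi}{2\ell(e)}I\Bigr)$$ with domain $\{(\xi_e)\in H_{\mathcal G}:\ \xi_e\in\operatorname{dom}D_{\ell(e)}\text{ for all }e,\ \sum_e\|(D_{\ell(e)}+\tfrac{\pi}{2\ell(e)}I)\xi_e\|^2<\infty\}$. Say that $[D_{\mathcal G},\pi(f)]$ is bounded if $\pi(f)\operatorname{dom}D_{\mathcal G}\subset\operatorname{dom}D_{\mathcal G}$ and $D_{\mathcal G}\pi(f)-\pi(f)D_{\mathcal G}$ on $\operatorname{dom}D_{\mathcal G}$ extends to a bounded operator on $H_{\mathcal G}$; its norm is then the norm of this extension. Then: 1. $\mathcal T$ is compact and $(C(\mathcal T),H_{\mathcal G},D_{\mathcal G})$ is a spectral triple: $\pi$ is faithful, $D_{\mathcal G}$ is self-adjoint, the set of $f\in C(\mathcal T)$ for which $[D_{\mathcal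 G},\pi(f)]$ is bounded is dense in $C(\mathcal T)$, and $(I+D_{\mathcal G}^2)^{-1}$ is compact. 2. If $s>0$ and the triple is $s$-summable, that is, $\operatorname{tr}\bigl((I+D_{\mathcal G}^2)^{-s/2}\bigr)<\infty$, then $s>1$. For $s>1$, the triple is $s$-summable if and only if $\sum_{e\in\mathcal E}\ell(e)^s<\infty$. 3. For all $x,y\in\mathcal P$, $$\sup\bigl\{|f(x)-f(y)|:\ f\in C(\mathcal T),\ \|[D_{\mathcal G},\pi(f)]\|\le1\bigr\}=d_{geo}(x,y),$$ where the geodesic distance $d_{geo}(x,y)$ is the infimum of the sums $\sum_i|s_i-t_i|$ over all curves from $x$ to $y$ composed of finitely many consecutive pieces, the $i$-th of which runs from $e^{(i)}_u(s_i)$ to $e^{(i)}_u(t_i)$ along an edge $e^{(i)}$. -/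

import Mathlib

open MeasureTheory Set
open scoped ENNReal InnerProductSpace

noncomputable section

namespace TreeTriple

section Unbounded

universe u v

/-- The data `(A, H, D)`: a unital representation of a unital C*-algebra `A` on a Hilbert space `H`
together with an unbounded operator `D` on `H`. -/
structure Triple (A : Type u) [CStarAlgebra A] (H : Type v) [NormedAddCommGroup H]
    [InnerProductSpace ℂ H] [CompleteSpace H] where
  rep : A →⋆ₐ[ℂ] (H →L[ℂ] H)
  dirac : H →ₗ.[ℂ] H

variable {H : Type v} [NormedAddCommGroup H] [InnerProductSpace ℂ H] [CompleteSpace H]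

/-- `B` is the bounded extension of the commutator `[D, S] = D S - S D`: the bounded operator `S`
maps `dom D` into itself, and `D S ξ - S D ξ = B ξ` for all `ξ ∈ dom D`. (If `D` is densely
defined, there is at most one such `B`.) -/
def IsCommutator (D : H →ₗ.[ℂ] H) (S B : H →L[ℂ] H) : Prop :=
  ∃ h : ∀ ξ : D.domain, S ξ ∈ D.domain, ∀ ξ : D.domain, D ⟨S ξ, h ξ⟩ - S (D ξ) = B ξ

/-- `R` is the inverse `(I + D²)⁻¹`, where `dom D² = {ξ ∈ dom D | D ξ ∈ dom D}`. -/
def IsInvOneAddSq (D : H →ₗ.[ℂ] H) (R : H →L[ℂ] H) : Prop :=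
  (∀ η : H, ∃ (h₁ : R η ∈ D.domain) (h₂ : D ⟨R η, h₁⟩ ∈ D.domain),
      R η + D ⟨D ⟨R η, h₁⟩, h₂⟩ = η) ∧
  ∀ (ξ : D.domain) (h : D ξ ∈ D.domain), R (ξ + D ⟨D ξ, h⟩) = ξ

/-- A positive bounded operator has finite trace: the sum of its diagonal entries converges, in
every orthonormal basis. -/
def HasFiniteTrace (S : H →L[ℂ] H) : Prop :=
  ∀ (w : Set H) (b : HilbertBasis w ℂ H), Summable fun i => (⟪b i, S (b i)⟫_ℂ).re

variable {A : Type u} [CStarAlgebra A]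

/-- Unbounded Fredholm module over `A`. -/
structure Triple.IsFredholmModule (M : Triple A H) : Prop where
  selfAdjoint : Dense (M.dirac.domain : Set H) ∧ IsSelfAdjoint M.dirac
  dense_boundedCommutator : Dense {a : A | ∃ B, IsCommutator M.dirac (M.rep a) B}
  compact : ∃ R : H →L[ℂ] H, IsInvOneAddSq M.dirac R ∧ IsCompactOperator R

/-- Spectral triple for `A`: an unbounded Fredholm module whose representation is faithful. -/
structure Triple.IsSpectralTriple (M : Triple A H) : Prop extends M.IsFredholmModule where
  faithful : Function.Injective M.rep

/-- `s`-summability, for a positive real number `s`: `tr ((I + D²)^(-s/2)) < ∞`. The real power of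
the positive operator `(I + D²)⁻¹` is the one of the continuous functional calculus. -/
def Triple.IsSummable (M : Triple A H) (s : ℝ) : Prop :=
  0 < s ∧ ∃ R : H →L[ℂ] H, IsInvOneAddSq M.dirac R ∧ HasFiniteTrace (R ^ (s / 2))

/-- The metric induced by `(C(X), H, D)` on `X`:
`d(x, y) = sup {|f x - f y| : ‖[D, π(f)]‖ ≤ 1}`, with values in `[0, ∞]`. -/
def Triple.inducedDist {X : Type u} [TopologicalSpace X] [CompactSpace X]
    (M : Triple C(X, ℂ) H) (x y : X) : ℝ≥0∞ :=
  ⨆ (f : C(X, ℂ)) (_ : ∃ B, IsCommutator M.dirac (M.rep f) B ∧ ‖B‖ ≤ 1),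
    ENNReal.ofReal ‖f x - f y‖

/-- The same representation, with the operator `D + a I` in the place of `D`. -/
def Triple.translate (M : Triple A H) (a : ℝ) : Triple A H where
  rep := M.rep
  dirac := ((a : ℂ) • LinearMap.id : H →ₗ[ℂ] H) +ᵥ M.dirac

/-- The sequences `c i ⟨b i, ξ⟩` are square summable for the vectors `ξ` of this subspace. -/
def diagonalDomain {ι : Type*} (b : HilbertBasis ι ℂ H) (c : ι → ℝ) : Submodule ℂ H where
  carrier := {ξ | Memℓp (fun i => (c i : ℂ) * b.repr ξ i) 2}
  add_mem' := by
    intro x y hx hy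
    have h := Memℓp.add hx hy
    have e : ((fun i => (c i : ℂ) * b.repr x i) + fun i => (c i : ℂ) * b.repr y i) =
        fun i => (c i : ℂ) * b.repr (x + y) i := by
      ext i
      simp [mul_add]
    rw [e] at h
    exact h
  zero_mem' := by
    change Memℓp _ 2
    simpa using! (zero_memℓp : Memℓp (0 : ι → ℂ) 2)
  smul_mem' := by
    intro a x hx
    have h := Memℓp.const_smul hx a
    have e : (a • fun i => (c i : ℂ) * b.repr x i) =
        fun i => (c i : ℂ) * b.repr (a • x) i := by
      ext i
      simp
      ring
    rw [e] at h
    exact h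

/-- The square summable sequence of the `c i ⟨b i, ξ⟩`. -/
def diagonalSeq {ι : Type*} (b : HilbertBasis ι ℂ H) (c : ι → ℝ) :
    diagonalDomain b c →ₗ[ℂ] lp (fun _ : ι => ℂ) 2 where
  toFun ξ := ⟨fun i => (c i : ℂ) * b.repr ξ i, ξ.2⟩
  map_add' x y := by
    ext i
    change (c i : ℂ) * b.repr ((x : H) + y) i = c i * b.repr x i + c i * b.repr y i
    simp [mul_add]
  map_smul' a x := by
    ext i
    change (c i : ℂ) * b.repr (a • (x : H)) i = a * (c i * b.repr x i)
    simp
    ring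

/-- The operator with eigenvectors `b i` and real eigenvalues `c i`,
`ξ ↦ ∑ c i ⟨b i, ξ⟩ b i`, on its maximal domain `{ξ | ∑ |c i ⟨b i, ξ⟩|² < ∞}`. -/
def diagonalOp {ι : Type*} (b : HilbertBasis ι ℂ H) (c : ι → ℝ) : H →ₗ.[ℂ] H where
  domain := diagonalDomain b c
  toFun := b.repr.symm.toLinearEquiv.toLinearMap ∘ₗ diagonalSeq b c

end Unbounded

section DirectSum

universe u v w

variable {ι : Type w} {H : ι → Type v} [∀ i, NormedAddCommGroup (H i)]
  [∀ i, InnerProductSpace ℂ (H i)]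

/-- The direct sum of a uniformly bounded family of operators, on the Hilbert space direct sum. -/
def sumCLM (S : ∀ i, H i →L[ℂ] H i) (C : ℝ) (hC : 0 ≤ C) (hS : ∀ i, ‖S i‖ ≤ C) :
    lp H 2 →L[ℂ] lp H 2 :=
  have hb : ∀ (ξ : lp H 2) (i : ι), ‖S i (ξ i)‖ ≤ ‖((C : ℂ) • ξ) i‖ := fun ξ i => by
    rw [lp.coeFn_smul, Pi.smul_apply, norm_smul, Complex.norm_real, Real.norm_of_nonneg hC]
    exact ((S i).le_opNorm _).trans (mul_le_mul_of_nonneg_right (hS i) (norm_nonneg _))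
  LinearMap.mkContinuous
    { toFun := fun ξ => ⟨fun i => S i (ξ i), (lp.memℓp ((C : ℂ) • ξ)).mono' (hb ξ)⟩
      map_add' := fun x y => by
        ext i
        simp
        rfl
      map_smul' := fun a x => by
        ext i
        simp }
    C (fun ξ => by
      have h := lp.norm_mono (p := 2) two_ne_zero
        (x := (⟨fun i => S i (ξ i), (lp.memℓp ((C : ℂ) • ξ)).mono' (hb ξ)⟩ : lp H 2))
        (y := (C : ℂ) • ξ) (hb ξ)
      rw [norm_smul, Complex.norm_real, Real.norm_of_nonneg hC] at h
      exact h)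

@[simp]
theorem sumCLM_apply (S : ∀ i, H i →L[ℂ] H i) (C : ℝ) (hC : 0 ≤ C) (hS : ∀ i, ‖S i‖ ≤ C)
    (ξ : lp H 2) (i : ι) : sumCLM S C hC hS ξ i = S i (ξ i) := rfl

/-- The direct sum of unbounded operators `D i`, with domain
`{ξ | ξ i ∈ dom (D i) for all i, and ∑ ‖D i (ξ i)‖² < ∞}`. -/
def sumPMap (D : ∀ i, H i →ₗ.[ℂ] H i) : lp H 2 →ₗ.[ℂ] lp H 2 where
  domain :=
    { carrier := {ξ | ∃ h : ∀ i, ξ i ∈ (D i).domain, Memℓp (fun i => D i ⟨ξ i, h i⟩) 2}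
      add_mem' := by
        rintro x y ⟨hx, hx'⟩ ⟨hy, hy'⟩
        refine ⟨fun i => (D i).domain.add_mem (hx i) (hy i), ?_⟩
        have h := hx'.add hy'
        have e : ((fun i => D i ⟨x i, hx i⟩) + fun i => D i ⟨y i, hy i⟩) =
            fun i => D i ⟨(x + y) i, (D i).domain.add_mem (hx i) (hy i)⟩ := by
          funext i
          exact ((D i).map_add ⟨x i, hx i⟩ ⟨y i, hy i⟩).symm
        rw [e] at h
        exact h
      zero_mem' := by
        refine ⟨fun i => (D i).domain.zero_mem, ?_⟩
        have e : (fun i => D i ⟨(0 : lp H 2) i, (D i).domain.zero_mem⟩) = 0 := by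
          funext i
          exact (D i).map_zero
        rw [e]
        exact zero_memℓp
      smul_mem' := by
        rintro a x ⟨hx, hx'⟩
        refine ⟨fun i => (D i).domain.smul_mem a (hx i), ?_⟩
        have h := hx'.const_smul a
        have e : (a • fun i => D i ⟨x i, hx i⟩) =
            fun i => D i ⟨(a • x) i, (D i).domain.smul_mem a (hx i)⟩ := by
          funext i
          exact ((D i).map_smul a ⟨x i, hx i⟩).symm
        rw [e] at h
        exact h }
  toFun :=
    { toFun := fun ξ => ⟨fun i => D i ⟨ξ.1 i, ξ.2.choose i⟩, ξ.2.choose_spec⟩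
      map_add' := by
        intro x y
        ext i
        exact (D i).map_add ⟨x.1 i, x.2.choose i⟩ ⟨y.1 i, y.2.choose i⟩
      map_smul' := by
        intro a x
        ext i
        exact (D i).map_smul a ⟨x.1 i, x.2.choose i⟩ }

variable [∀ i, CompleteSpace (H i)] {A : Type u} [CStarAlgebra A]

/-- The direct sum of a family of triples over the same C*-algebra. -/
def directSum (M : ∀ i, Triple A (H i)) : Triple A (lp H 2) where
  rep :=
    { toFun := fun a => sumCLM (fun i => (M i).rep a) ‖a‖ (norm_nonneg a)
        fun i => NonUnitalStarAlgHom.norm_apply_le (M i).rep a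
      map_one' := by
        ext ξ i
        simp
      map_mul' := fun a b => by
        ext ξ i
        simp
      map_zero' := by
        ext ξ i
        simp
      map_add' := fun a b => by
        ext ξ i
        simp
      commutes' := fun c => by
        ext ξ i
        simp [Algebra.algebraMap_eq_smul_one]
      map_star' := fun a => by
        rw [ContinuousLinearMap.star_eq_adjoint, ContinuousLinearMap.eq_adjoint_iff]
        intro x y
        simp only [lp.inner_eq_tsum, sumCLM_apply, map_star, ContinuousLinearMap.star_eq_adjoint,
          ContinuousLinearMap.adjoint_inner_left] }
  dirac := sumPMap fun i => (M i).dirac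

end DirectSum

section Interval

/-- Normalized Lebesgue measure on `[-α, α]`. -/
def intervalMeasure (α : ℝ) : Measure ℝ :=
  (ENNReal.ofReal (2 * α))⁻¹ • volume.restrict (Icc (-α) α)

/-- The Hilbert space `L²([-α, α], m / 2α)`. -/
abbrev IntervalL2 (α : ℝ) : Type := Lp ℂ 2 (intervalMeasure α)

/-- The function `t ↦ f |t|` on `[-α, α]` (continued by the constant `f α` outside `[-α, α]`). -/
def evenExtension {α : ℝ} (hα : 0 < α) (f : C(Icc (0 : ℝ) α, ℂ)) : C(ℝ, ℂ) :=
  ⟨fun t => f (projIcc 0 α hα.le |t|),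
    f.continuous.comp (continuous_projIcc.comp continuous_abs)⟩

theorem memLp_evenExtension {α : ℝ} (hα : 0 < α) (f : C(Icc (0 : ℝ) α, ℂ)) :
    MemLp (evenExtension hα f) ∞ (intervalMeasure α) :=
  memLp_top_of_bound (evenExtension hα f).continuous.aestronglyMeasurable ‖f‖
    (Filter.Eventually.of_forall fun _ => f.norm_coe_le_norm _)

/-- Multiplication by the function `t ↦ f |t|` on `L²([-α, α], m / 2α)`. -/
def mulOp {α : ℝ} (hα : 0 < α) (f : C(Icc (0 : ℝ) α, ℂ)) : IntervalL2 α →L[ℂ] IntervalL2 α :=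
  (ContinuousLinearMap.mul ℂ ℂ).holderL (intervalMeasure α) ∞ 2 2 (memLp_evenExtension hα f).toLp

theorem coeFn_mulOp {α : ℝ} (hα : 0 < α) (f : C(Icc (0 : ℝ) α, ℂ)) (ξ : IntervalL2 α) :
    mulOp hα f ξ =ᵐ[intervalMeasure α] fun t => evenExtension hα f t * ξ t := by
  have h1 := (ContinuousLinearMap.mul ℂ ℂ).coeFn_holder (r := 2)
    (memLp_evenExtension hα f).toLp ξ
  filter_upwards [h1, (memLp_evenExtension hα f).coeFn_toLp] with t h1 h2
  rw [← h2]
  exact h1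

/-- The representation of `C([0, α])` on `L²([-α, α], m / 2α)` by multiplication operators. -/
def intervalRep {α : ℝ} (hα : 0 < α) :
    C(Icc (0 : ℝ) α, ℂ) →⋆ₐ[ℂ] (IntervalL2 α →L[ℂ] IntervalL2 α) where
  toFun := mulOp hα
  map_one' := by
    ext1 ξ
    apply Lp.ext
    filter_upwards [coeFn_mulOp hα 1 ξ] with t h
    simpa [evenExtension] using! h
  map_mul' f g := by
    ext1 ξ
    apply Lp.ext
    filter_upwards [coeFn_mulOp hα (f * g) ξ, coeFn_mulOp hα f (mulOp hα g ξ),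
      coeFn_mulOp hα g ξ] with t h1 h2 h3
    rw [h1]
    change _ = mulOp hα f (mulOp hα g ξ) t
    rw [h2, h3]
    simp [evenExtension, mul_assoc]
  map_zero' := by
    ext1 ξ
    apply Lp.ext
    filter_upwards [coeFn_mulOp hα 0 ξ, Lp.coeFn_zero ℂ 2 (intervalMeasure α)] with t h h0
    rw [h, zero_apply, h0]
    simp [evenExtension]
  map_add' f g := by
    ext1 ξ
    apply Lp.ext
    filter_upwards [coeFn_mulOp hα (f + g) ξ, coeFn_mulOp hα f ξ, coeFn_mulOp hα g ξ,
      Lp.coeFn_add (mulOp hα f ξ) (mulOp hα g ξ)] with t h1 h2 h3 h4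
    rw [h1, add_apply, h4, Pi.add_apply, h2, h3]
    simp [evenExtension, add_mul]
  commutes' c := by
    ext1 ξ
    apply Lp.ext
    filter_upwards [coeFn_mulOp hα (algebraMap ℂ _ c) ξ, Lp.coeFn_smul c ξ] with t h1 h2
    have e : algebraMap ℂ (IntervalL2 α →L[ℂ] IntervalL2 α) c ξ = c • ξ := by
      simp [Algebra.algebraMap_eq_smul_one]
    rw [h1, e, h2]
    simp [evenExtension]
  map_star' f := by
    rw [ContinuousLinearMap.star_eq_adjoint, ContinuousLinearMap.eq_adjoint_iff]
    intro x y
    rw [L2.inner_def, L2.inner_def]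
    apply integral_congr_ae
    filter_upwards [coeFn_mulOp hα (star f) x, coeFn_mulOp hα f y] with t h1 h2
    rw [h1, h2]
    simp [evenExtension]
    ring

theorem measurePreserving_toCircle {α : ℝ} [Fact (0 < 2 * α)] :
    MeasurePreserving (fun x : ℝ => (x : AddCircle (2 * α))) (intervalMeasure α)
      AddCircle.haarAddCircle := by
  have hT : (0 : ℝ) < 2 * α := Fact.out
  have h := (AddCircle.measurePreserving_mk (2 * α) (-α)).smul_measure (ENNReal.ofReal (2 * α))⁻¹
  rw [AddCircle.volume_eq_smul_haarAddCircle, smul_smul,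
    ENNReal.inv_mul_cancel (by positivity) ENNReal.ofReal_ne_top, one_smul] at h
  have e : -α + 2 * α = α := by ring
  rw [e, Measure.restrict_congr_set Ioc_ae_eq_Icc] at h
  exact h

/-- The section `AddCircle (2 α) → (-α, α]` of the quotient map. -/
def fromCircle {α : ℝ} [Fact (0 < 2 * α)] (x : AddCircle (2 * α)) : ℝ :=
  AddCircle.equivIoc (2 * α) (-α) x

theorem toCircle_fromCircle {α : ℝ} [Fact (0 < 2 * α)] (x : AddCircle (2 * α)) :
    ((fromCircle x : ℝ) : AddCircle (2 * α)) = x :=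
  AddCircle.coe_equivIoc

theorem fromCircle_toCircle_ae {α : ℝ} [Fact (0 < 2 * α)] :
    (fun x : ℝ => fromCircle (x : AddCircle (2 * α))) =ᵐ[intervalMeasure α] id := by
  apply Measure.ae_smul_measure
  rw [← Measure.restrict_congr_set Ioc_ae_eq_Icc]
  filter_upwards [ae_restrict_mem measurableSet_Ioc] with x hx
  apply AddCircle.equivIoc_coe_of_mem
  rwa [show -α + 2 * α = α by ring]

theorem measurePreserving_fromCircle {α : ℝ} [Fact (0 < 2 * α)] :
    MeasurePreserving (fromCircle (α := α)) AddCircle.haarAddCircle (intervalMeasure α) := by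
  have hm : Measurable (fromCircle (α := α)) :=
    measurable_subtype_coe.comp (AddCircle.measurableEquivIoc (2 * α) (-α)).measurable
  refine ⟨hm, ?_⟩
  rw [← measurePreserving_toCircle.map_eq, Measure.map_map hm measurePreserving_toCircle.measurable]
  exact (Measure.map_congr fromCircle_toCircle_ae).trans Measure.map_id

/-- Functions on the circle of length `2 α`, seen as functions on `[-α, α]`. -/
def circleEquiv (α : ℝ) [Fact (0 < 2 * α)] :
    Lp ℂ 2 (AddCircle.haarAddCircle (T := 2 * α)) ≃ₗᵢ[ℂ] IntervalL2 α :=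
  LinearIsometryEquiv.ofSurjective
    (Lp.compMeasurePreservingₗᵢ ℂ _ measurePreserving_toCircle) (fun g => by
      refine ⟨Lp.compMeasurePreserving _ measurePreserving_fromCircle g, ?_⟩
      change Lp.compMeasurePreserving _ measurePreserving_toCircle _ = _
      apply Lp.ext
      have h1 := Lp.coeFn_compMeasurePreserving
        (Lp.compMeasurePreserving _ measurePreserving_fromCircle g) measurePreserving_toCircle
      have h2 := measurePreserving_toCircle.quasiMeasurePreserving.ae_eq_comp
        (Lp.coeFn_compMeasurePreserving g measurePreserving_fromCircle)
      filter_upwards [h1, h2, fromCircle_toCircle_ae (α := α)] with t h1 h2 h3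
      rw [h1, h2]
      simp only [Function.comp_apply, h3, id])

/-- The orthonormal basis `e_k(x) = exp (i π k x / α)`, `k ∈ ℤ`, of `L²([-α, α], m / 2α)`. -/
def intervalBasis {α : ℝ} (hα : 0 < α) : HilbertBasis ℤ ℂ (IntervalL2 α) :=
  haveI : Fact (0 < 2 * α) := ⟨by positivity⟩
  HilbertBasis.ofRepr ((circleEquiv α).symm.trans fourierBasis.repr)

theorem coeFn_intervalBasis {α : ℝ} (hα : 0 < α) (k : ℤ) :
    intervalBasis hα k =ᵐ[intervalMeasure α]
      fun x => Complex.exp (Complex.I * Real.pi * k * x / α) := by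
  classical
  have : Fact (0 < 2 * α) := ⟨by positivity⟩
  have e : intervalBasis hα k =
      Lp.compMeasurePreserving _ measurePreserving_toCircle (fourierLp 2 k) := by
    rw [← coe_fourierBasis, ← HilbertBasis.repr_symm_single, ← HilbertBasis.repr_symm_single]
    rfl
  rw [e]
  filter_upwards [Lp.coeFn_compMeasurePreserving (fourierLp 2 k) measurePreserving_toCircle,
    measurePreserving_toCircle.quasiMeasurePreserving.ae_eq_comp
      (coeFn_fourierLp (T := 2 * α) 2 k)] with x h1 h2
  rw [h1, h2, Function.comp_apply, fourier_coe_apply]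
  congr 1
  have : (α : ℂ) ≠ 0 := by exact_mod_cast hα.ne'
  push_cast
  field_simp

/-- The operator on `L²([-α, α], m / 2α)` with `D e_k = (π k / α) e_k`. -/
def intervalDirac {α : ℝ} (hα : 0 < α) : IntervalL2 α →ₗ.[ℂ] IntervalL2 α :=
  diagonalOp (intervalBasis hα) fun k => Real.pi * k / α

/-- The triple of a curve `r : [0, α] → X`: the functions on `X` are pulled back to `[0, α]` along
`r`, extended to even functions on `[-α, α]`, and act by multiplication. -/
def curveTriple {X : Type*} [TopologicalSpace X] [CompactSpace X] {α : ℝ} (hα : 0 < α)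
    (r : C(Icc (0 : ℝ) α, X)) : Triple C(X, ℂ) (IntervalL2 α) where
  rep := (intervalRep hα).comp (ContinuousMap.compStarAlgHom' ℂ ℂ r)
  dirac := intervalDirac hα

end Interval

section Geodesic

variable {E X : Type*} {ℓ : E → ℝ}

/-- `IsCurve r x y L`: there is a curve from `x` to `y` composed of finitely many pieces, each of
which runs from some `r e s` to some `r e t` along an edge `e`, such that the sum of the lengths
`|s - t|` of the pieces is `L`. -/
inductive IsCurve (r : ∀ e, Icc (0 : ℝ) (ℓ e) → X) : X → X → ℝ → Prop
  | nil (x : X) : IsCurve r x x 0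
  | cons (e : E) (s t : Icc (0 : ℝ) (ℓ e)) (y : X) (L : ℝ) (h : IsCurve r (r e t) y L) :
      IsCurve r (r e s) y (|(s : ℝ) - t| + L)

/-- The geodesic distance (infinite if there is no curve from `x` to `y`). -/
def geoDist (r : ∀ e, Icc (0 : ℝ) (ℓ e) → X) (x y : X) : ℝ≥0∞ :=
  ⨅ (L : ℝ) (_ : IsCurve r x y L), ENNReal.ofReal L

end Geodesic

section Tree

universe u

variable {V : Type u} {G : SimpleGraph V} (hG : G.IsTree) (ℓ : G.edgeSet → ℝ)
  (p : ℝ≥0∞) (u : V)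

/-- The unique path from `u` to `w`. -/
def treePath (w : V) : G.Walk u w := (hG.existsUnique_path u w).choose

open scoped Classical in
/-- The vertex `w` as a point of `ℓ^p(E)`: the sum of the `ℓ(e) δ_e` over the edges `e` of the path
from `u` to `w`. -/
def vertexPoint (w : V) : lp (fun _ : G.edgeSet => ℝ) p :=
  ((treePath hG u w).darts.map fun d =>
    lp.single p (⟨d.edge, d.edge_mem⟩ : G.edgeSet) (ℓ ⟨d.edge, d.edge_mem⟩)).sum

theorem exists_nearEnd (G : SimpleGraph V) (u : V) (e : Sym2 V) :
    ∃ w ∈ e, ∀ v ∈ e, G.dist u w ≤ G.dist u v := by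
  induction e with
  | _ x y =>
    rcases le_total (G.dist u x) (G.dist u y) with h | h
    · exact ⟨x, by simp, by simp [h]⟩
    · exact ⟨y, by simp, by simp [h]⟩

/-- The end of the edge `e` which is nearest to `u`. -/
def nearEnd (G : SimpleGraph V) (u : V) (e : Sym2 V) : V := (exists_nearEnd G u e).choose

open scoped Classical in
/-- The curve `e_u(t) = T_u(w) + t δ_e`, where `w` is the end of `e` which is nearest to `u`. -/
def edgePoint (e : G.edgeSet) (t : ℝ) : lp (fun _ : G.edgeSet => ℝ) p :=
  vertexPoint hG ℓ p u (nearEnd G u e) + t • lp.single p e 1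

/-- The set of the points on all edges. -/
def treePoints : Set (lp (fun _ : G.edgeSet => ℝ) p) :=
  {x | ∃ e, ∃ t ∈ Icc 0 (ℓ e), edgePoint hG ℓ p u e t = x}

variable [Fact (1 ≤ p)]

/-- The space of the `p`-parameterization: the closure in `ℓ^p(E)` of the set of the points on all
edges. -/
abbrev TreeSpace : Type u := closure (treePoints hG ℓ p u)

/-- The parameterization of an edge as a curve in the space of the `p`-parameterization. -/
def edgeCurve (e : G.edgeSet) : C(Icc (0 : ℝ) (ℓ e), TreeSpace hG ℓ p u) where
  toFun t := ⟨edgePoint hG ℓ p u e t, subset_closure ⟨e, t, t.2, rfl⟩⟩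
  continuous_toFun := by
    unfold edgePoint
    fun_prop

/-- The direct sum over the edges of the triples `(C(T), H_ℓ(e), D_ℓ(e) + π / (2 ℓ(e)) I)`. -/
def treeTriple [CompactSpace (TreeSpace hG ℓ p u)] (hℓ : ∀ e, 0 < ℓ e) :
    Triple C(TreeSpace hG ℓ p u, ℂ) (lp (fun e : G.edgeSet => IntervalL2 (ℓ e)) 2) :=
  directSum fun e =>
    (curveTriple (hℓ e) (edgeCurve hG ℓ p u e)).translate (Real.pi / (2 * ℓ e))

end Tree

end TreeTriple

end

set_option linter.unusedSectionVars false

/-! The operator is diagonal. The vectors `e_k`, one copy for each edge, form a Hilbert basis of the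
direct sum, and the eigenvalue at `(e, k)` is `π k / ℓ e + π / (2 ℓ e) = (π / 2) (2 k + 1) / ℓ e`.
Self-adjointness, the resolvent, its compactness and the trace are therefore statements about these
numbers. Since `2 k + 1` is never zero, `∑ (1 + λ²) ^ (-s/2)` is bounded by `∑ ℓ e ^ s` times `∑ |2
k + 1| ^ (-s)`. The eigenvalues of one edge force `1 < s`, and those with `k = 0` force `∑ ℓ e ^ s <
∞`.

The commutator with a bounded `S` has the matrix `(c n - c k) ⟪b n, S (b k)⟫`
(`isCommutator_diagonalOp_iff`), in which the shift `π / (2 ℓ e)` cancels. On a single edge the flow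
`e^{iτD}` rotates the circle of length `2 ℓ e` by `τ`, so a bound on the commutator bounds the norm
of multiplication by `f |x + τ| - f |x|`. Hence `f` is Lipschitz along each edge
(`lipschitz_of_commutator`), and the induced distance is at most the geodesic one.

For the reverse inequality, the coordinates of `ℓ^p(E)` serve as test functions. A finite sum `∑ ε e
* x e` with `|ε e| ≤ 1` is affine of slope `ε e` or `0` on each edge, so its commutator has norm at
most `1` (`exists_commutator_coordinateSum`). With `ε` the signs of `x e - y e`, these functions
approach the `ℓ¹`-distance of `x` and `y`, which is the length of a curve joining them
(`joinedByGeodesic_of_mem_treePoints`). The coordinates also separate points, so Stone–Weierstrass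
yields density. Compactness holds because the space is closed in the box `∏ [0, ℓ e]`, which is
compact in `ℓ^p`. -/

namespace TreeTriple

/-! ### Diagonal operators and their commutators -/

section Diagonal

variable {H : Type*} [NormedAddCommGroup H] [InnerProductSpace ℂ H] [CompleteSpace H]
  {ι : Type*} (b : HilbertBasis ι ℂ H) (c : ι → ℝ)

theorem ext_repr {x y : H} (h : ∀ i, b.repr x i = b.repr y i) : x = y :=
  b.repr.injective (lp.ext (funext h))

theorem dense_span_basis : Dense (Submodule.span ℂ (Set.range b) : Set H) := by
  rw [dense_iff_closure_eq, ← Submodule.topologicalClosure_coe, b.dense_span]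
  rfl

theorem ext_basis {S T : H →L[ℂ] H} (h : ∀ i, S (b i) = T (b i)) : S = T := by
  refine ContinuousLinearMap.ext_on (s := Set.range b) (dense_span_basis b) ?_
  rintro _ ⟨i, rfl⟩
  exact h i

theorem mem_diagonalOp_domain {ξ : H} :
    ξ ∈ (diagonalOp b c).domain ↔ Memℓp (fun i => (c i : ℂ) * b.repr ξ i) 2 := Iff.rfl

theorem repr_diagonalOp (ξ : (diagonalOp b c).domain) (i : ι) :
    b.repr (diagonalOp b c ξ) i = c i * b.repr ξ i := by
  change b.repr (b.repr.symm (diagonalSeq b c ξ)) i = _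
  rw [LinearIsometryEquiv.apply_symm_apply]
  rfl

theorem mem_diagonalOp_domain_of_repr {ξ η : H} (h : ∀ i, b.repr η i = c i * b.repr ξ i) :
    ξ ∈ (diagonalOp b c).domain := by
  rw [mem_diagonalOp_domain]
  simp_rw [← h]
  exact lp.memℓp _

theorem diagonalOp_eq_of_repr {ξ η : H} (h : ∀ i, b.repr η i = c i * b.repr ξ i) :
    diagonalOp b c ⟨ξ, mem_diagonalOp_domain_of_repr b c h⟩ = η :=
  ext_repr b fun i => by rw [repr_diagonalOp, h]

theorem repr_smul_basis (a : ℂ) (i k : ι) (f : ι → ℂ) :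
    b.repr ((f i * a) • b i) k = f k * b.repr (a • b i) k := by
  classical
  rw [map_smul, map_smul, b.repr_self, lp.coeFn_smul, lp.coeFn_smul, Pi.smul_apply, Pi.smul_apply,
    lp.single_apply]
  by_cases h : k = i
  · subst h; simp
  · simp [h]

theorem basis_mem_domain (i : ι) : b i ∈ (diagonalOp b c).domain := by
  refine mem_diagonalOp_domain_of_repr b c (η := (c i : ℂ) • b i) fun k => ?_
  simpa using repr_smul_basis b 1 i k (fun j => (c j : ℂ))

theorem diagonalOp_basis (i : ι) (h : b i ∈ (diagonalOp b c).domain) :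
    diagonalOp b c ⟨b i, h⟩ = (c i : ℂ) • b i := by
  refine diagonalOp_eq_of_repr b c fun k => ?_
  simpa using repr_smul_basis b 1 i k (fun j => (c j : ℂ))

theorem dense_diagonalOp_domain : Dense ((diagonalOp b c).domain : Set H) := by
  have h : Submodule.span ℂ (Set.range b) ≤ (diagonalOp b c).domain := by
    rw [Submodule.span_le]
    rintro _ ⟨i, rfl⟩
    exact basis_mem_domain b c i
  exact (dense_span_basis b).mono h

theorem diagonalOp_symmetric (x y : (diagonalOp b c).domain) :
    ⟪diagonalOp b c x, (y : H)⟫_ℂ = ⟪(x : H), diagonalOp b c y⟫_ℂ := by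
  rw [← b.repr.inner_map_map, ← b.repr.inner_map_map, lp.inner_eq_tsum, lp.inner_eq_tsum]
  congr 1
  funext i
  rw [repr_diagonalOp, repr_diagonalOp]
  simp only [RCLike.inner_apply, map_mul, Complex.conj_ofReal]
  ring

/-- Symmetry gives one inclusion. Testing a vector `y` of the adjoint's domain against `b i` shows
that the adjoint multiplies coordinates by `c i`, so `y` is already in the maximal domain. -/
theorem isSelfAdjoint_diagonalOp : IsSelfAdjoint (diagonalOp b c) := by
  have hd := dense_diagonalOp_domain b c
  rw [LinearPMap.isSelfAdjoint_def]
  have hle : diagonalOp b c ≤ (diagonalOp b c).adjoint :=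
    LinearPMap.IsFormalAdjoint.le_adjoint hd fun x y => by
      exact diagonalOp_symmetric b c x y
  refine (LinearPMap.eq_of_le_of_domain_eq hle (le_antisymm hle.1 fun y hy => ?_)).symm
  refine mem_diagonalOp_domain_of_repr b c
    (η := (diagonalOp b c).adjoint ⟨y, hy⟩) fun i => ?_
  have h := LinearPMap.adjoint_isFormalAdjoint hd ⟨y, hy⟩ ⟨b i, basis_mem_domain b c i⟩
  rw [diagonalOp_basis] at h
  rw [b.repr_apply_apply, b.repr_apply_apply, ← inner_conj_symm, h, inner_smul_right, map_mul,
    Complex.conj_ofReal, inner_conj_symm]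

/-- In the converse, invariance of the domain comes for free: expanding in the basis, the vector `S
D ξ + B ξ` has coordinates `c n * (S ξ) n`, and its existence in `H` puts `S ξ` into the maximal
domain. -/
theorem isCommutator_diagonalOp_iff (S B : H →L[ℂ] H) :
    IsCommutator (diagonalOp b c) S B ↔
      ∀ n k, ⟪b n, B (b k)⟫_ℂ = (c n - c k) * ⟪b n, S (b k)⟫_ℂ := by
  constructor
  · rintro ⟨h, hc⟩ n k
    have h1 := hc ⟨b k, basis_mem_domain b c k⟩
    rw [← h1, diagonalOp_basis, map_smul, inner_sub_right, inner_smul_right,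
      ← b.repr_apply_apply, repr_diagonalOp, b.repr_apply_apply]
    ring
  · intro h
    have key : ∀ (ξ : (diagonalOp b c).domain) (n : ι),
        b.repr (S (diagonalOp b c ξ) + B ξ) n = c n * b.repr (S ξ) n := by
      intro ξ n
      have e : ∀ (T : H →L[ℂ] H) (x : H),
          HasSum (fun k => b.repr x k * ⟪b n, T (b k)⟫_ℂ) (b.repr (T x) n) := by
        intro T x
        have := (b.hasSum_repr x).mapL ((innerSL ℂ (b n)).comp T)
        simpa [b.repr_apply_apply] using this
      have h1 := (e S (diagonalOp b c ξ)).add (e B ξ)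
      have h2 := (e S ξ).mul_left (c n : ℂ)
      rw [map_add, lp.coeFn_add, Pi.add_apply]
      have e3 : (fun k => (c n : ℂ) * (b.repr ξ k * ⟪b n, S (b k)⟫_ℂ)) = fun k =>
          b.repr (diagonalOp b c ξ) k * ⟪b n, S (b k)⟫_ℂ + b.repr ξ k * ⟪b n, B (b k)⟫_ℂ := by
        funext k
        rw [repr_diagonalOp, h]
        ring
      rw [e3] at h2
      exact h1.unique h2
    refine ⟨fun ξ => mem_diagonalOp_domain_of_repr b c (key ξ), fun ξ => ?_⟩
    rw [diagonalOp_eq_of_repr b c (key ξ)]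
    abel

theorem vadd_diagonalOp (a : ℝ) :
    ((a : ℂ) • LinearMap.id : H →ₗ[ℂ] H) +ᵥ diagonalOp b c = diagonalOp b fun i => c i + a := by
  have key : ∀ (ξ : (diagonalOp b c).domain) (i : ι),
      b.repr ((a : ℂ) • (ξ : H) + diagonalOp b c ξ) i = ((c i + a : ℝ) : ℂ) * b.repr ξ i := by
    intro ξ i
    rw [map_add, map_smul, lp.coeFn_add, Pi.add_apply, repr_diagonalOp, lp.coeFn_smul,
      Pi.smul_apply, smul_eq_mul]
    push_cast
    ring
  refine LinearPMap.ext (SetLike.ext fun ξ => ⟨fun h => ?_, fun h => ?_⟩) ?_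
  · exact mem_diagonalOp_domain_of_repr b _ (key ⟨ξ, h⟩)
  · refine mem_diagonalOp_domain_of_repr b c
      (η := diagonalOp b (fun i => c i + a) ⟨ξ, h⟩ - (a : ℂ) • ξ) fun i => ?_
    rw [map_sub, map_smul, lp.coeFn_sub, Pi.sub_apply, repr_diagonalOp, lp.coeFn_smul,
      Pi.smul_apply, smul_eq_mul]
    push_cast
    ring
  · intro ξ h1 h2
    exact (diagonalOp_eq_of_repr b _ (key ⟨ξ, h1⟩)).symm

end Diagonal

/-! ### The resolvent and its compactness -/

section Resolvent

theorem norm_sumCLM_le {ι : Type*} {H : ι → Type*} [∀ i, NormedAddCommGroup (H i)]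
    [∀ i, InnerProductSpace ℂ (H i)] (S : ∀ i, H i →L[ℂ] H i) (C : ℝ) (hC : 0 ≤ C)
    (hS : ∀ i, ‖S i‖ ≤ C) : ‖sumCLM S C hC hS‖ ≤ C := by
  unfold sumCLM
  apply LinearMap.mkContinuous_norm_le _ hC

theorem eq_zero_of_sumCLM_eq_zero {ι : Type*} {H : ι → Type*} [∀ i, NormedAddCommGroup (H i)]
    [∀ i, InnerProductSpace ℂ (H i)] {S : ∀ i, H i →L[ℂ] H i} {C : ℝ} {hC : 0 ≤ C}
    {hS : ∀ i, ‖S i‖ ≤ C} (h : sumCLM S C hC hS = 0) (i : ι) : S i = 0 := by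
  classical
  ext x
  have h1 := sumCLM_apply S C hC hS (lp.single 2 i x) i
  rw [h, lp.single_apply_self] at h1
  exact h1.symm

variable {H : Type*} [NormedAddCommGroup H] [InnerProductSpace ℂ H] [CompleteSpace H]
  {ι : Type*} (b : HilbertBasis ι ℂ H) (c : ι → ℝ)

theorem exists_bounded_diagonal (μ : ι → ℂ) (C : ℝ) (hC : 0 ≤ C) (h : ∀ i, ‖μ i‖ ≤ C) :
    ∃ T : H →L[ℂ] H, ‖T‖ ≤ C ∧ ∀ ξ i, b.repr (T ξ) i = μ i * b.repr ξ i := by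
  let S : ι → ℂ →L[ℂ] ℂ := fun i => μ i • ContinuousLinearMap.id ℂ ℂ
  have hS : ∀ i, ‖S i‖ ≤ C := fun i => by
    refine ContinuousLinearMap.opNorm_le_bound _ hC fun z => ?_
    change ‖μ i * z‖ ≤ _
    rw [norm_mul]
    exact mul_le_mul_of_nonneg_right (h i) (norm_nonneg z)
  let U : H →L[ℂ] lp (fun _ : ι => ℂ) 2 := b.repr.toContinuousLinearEquiv
  let V : lp (fun _ : ι => ℂ) 2 →L[ℂ] H := b.repr.symm.toContinuousLinearEquiv
  refine ⟨V.comp ((sumCLM S C hC hS).comp U), ?_, fun ξ i => ?_⟩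
  · refine ContinuousLinearMap.opNorm_le_bound _ hC fun ξ => ?_
    change ‖b.repr.symm (sumCLM S C hC hS (b.repr ξ))‖ ≤ _
    rw [LinearIsometryEquiv.norm_map, ← b.repr.norm_map ξ]
    refine (ContinuousLinearMap.le_opNorm _ _).trans ?_
    exact mul_le_mul_of_nonneg_right (norm_sumCLM_le S C hC hS) (norm_nonneg _)
  · change b.repr (b.repr.symm (sumCLM S C hC hS (b.repr ξ))) i = _
    rw [LinearIsometryEquiv.apply_symm_apply]
    simp [S]

theorem apply_basis_of_repr {T : H →L[ℂ] H} {μ : ι → ℂ}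
    (h : ∀ ξ i, b.repr (T ξ) i = μ i * b.repr ξ i) (i : ι) : T (b i) = μ i • b i :=
  ext_repr b fun k => by
    rw [h]
    simpa using (repr_smul_basis b 1 i k μ).symm

theorem abs_mul_inv_one_add_sq_le (x : ℝ) : |x * (1 + x ^ 2)⁻¹| ≤ 1 := by
  rw [abs_mul, abs_of_pos (a := (1 + x ^ 2)⁻¹) (by positivity), ← div_eq_mul_inv,
    div_le_one (by positivity)]
  nlinarith [sq_abs x, sq_nonneg (|x| - 1)]

/-- The left-inverse half of `IsInvOneAddSq` determines `R` on the basis; this yields uniqueness of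
the resolvent later. -/
theorem IsInvOneAddSq.apply_basis {R : H →L[ℂ] H} (hR : IsInvOneAddSq (diagonalOp b c) R)
    (i : ι) : R (b i) = (((1 + c i ^ 2)⁻¹ : ℝ) : ℂ) • b i := by
  have hd := basis_mem_domain b c i
  have h : diagonalOp b c ⟨b i, hd⟩ ∈ (diagonalOp b c).domain := by
    rw [diagonalOp_basis]
    exact Submodule.smul_mem _ _ hd
  have e : diagonalOp b c ⟨diagonalOp b c ⟨b i, hd⟩, h⟩ = ((c i : ℂ) ^ 2) • b i := by
    have : (⟨diagonalOp b c ⟨b i, hd⟩, h⟩ : (diagonalOp b c).domain) =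
        (c i : ℂ) • (⟨b i, hd⟩ : (diagonalOp b c).domain) :=
      Subtype.ext (diagonalOp_basis b c i hd)
    rw [this, LinearPMap.map_smul, diagonalOp_basis, smul_smul, sq]
  have h2 := hR.2 ⟨b i, hd⟩ h
  rw [e] at h2
  have e2 : b i + ((c i : ℂ) ^ 2) • b i = (1 + (c i : ℂ) ^ 2) • b i := by
    rw [add_smul, one_smul]
  have h0 : (1 + (c i : ℂ) ^ 2) ≠ 0 := by
    have : (1 + c i ^ 2 : ℝ) ≠ 0 := by positivity
    exact_mod_cast this
  change R (b i + _) = b i at h2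
  rw [e2, map_smul] at h2
  refine smul_right_injective H h0 ?_
  change (1 + (c i : ℂ) ^ 2) • _ = (1 + (c i : ℂ) ^ 2) • _
  rw [h2, smul_smul]
  push_cast
  rw [mul_inv_cancel₀ h0, one_smul]

theorem exists_isInvOneAddSq : ∃ R : H →L[ℂ] H, IsInvOneAddSq (diagonalOp b c) R ∧
    ∀ ξ i, b.repr (R ξ) i = (((1 + c i ^ 2)⁻¹ : ℝ) : ℂ) * b.repr ξ i := by
  have hpos : ∀ i, (1 + (c i : ℂ) ^ 2) ≠ 0 := fun i => by
    have : (1 + c i ^ 2 : ℝ) ≠ 0 := by positivity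
    exact_mod_cast this
  obtain ⟨R, -, hR⟩ := exists_bounded_diagonal b (fun i => (((1 + c i ^ 2)⁻¹ : ℝ) : ℂ)) 1 zero_le_one
    fun i => by
      rw [Complex.norm_real, Real.norm_of_nonneg (by positivity)]
      exact inv_le_one_of_one_le₀ (by nlinarith [sq_nonneg (c i)])
  -- `Q` plays the role of `D (1 + D²)⁻¹`. Then `D R η = Q η` and `D Q η = η - R η`, which gives
  -- both domain conditions.
  obtain ⟨Q, -, hQ⟩ := exists_bounded_diagonal b (fun i => ((c i * (1 + c i ^ 2)⁻¹ : ℝ) : ℂ)) 1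
    zero_le_one fun i => by
      rw [Complex.norm_real]
      exact abs_mul_inv_one_add_sq_le (c i)
  have h1 : ∀ η i, b.repr (Q η) i = c i * b.repr (R η) i := fun η i => by
    rw [hR, hQ]
    push_cast
    ring
  have h2 : ∀ η i, b.repr (η - R η) i = c i * b.repr (Q η) i := fun η i => by
    rw [map_sub, lp.coeFn_sub, Pi.sub_apply, hR, hQ]
    push_cast
    field_simp [hpos i]
    ring
  refine ⟨R, ⟨fun η => ?_, fun ξ h => ?_⟩, hR⟩
  · have e1 := diagonalOp_eq_of_repr b c (h1 η)
    have m2 := mem_diagonalOp_domain_of_repr b c (h2 η)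
    refine ⟨mem_diagonalOp_domain_of_repr b c (h1 η), by rw [e1]; exact m2, ?_⟩
    have e2 : ∀ h, diagonalOp b c ⟨diagonalOp b c ⟨R η, mem_diagonalOp_domain_of_repr b c (h1 η)⟩,
        h⟩ = η - R η := by
      rw [e1]
      exact fun _ => diagonalOp_eq_of_repr b c (h2 η)
    rw [e2]
    abel
  · refine ext_repr b fun i => ?_
    rw [hR, map_add, lp.coeFn_add, Pi.add_apply, repr_diagonalOp]
    change _ * (_ + _ * b.repr (diagonalOp b c ξ) i) = _
    rw [repr_diagonalOp]
    push_cast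
    have := hpos i
    field_simp

/-- Norm limit of finite-rank truncations: the remainder is diagonal, so its norm is controlled by
the largest entry that was left out. -/
theorem isCompactOperator_of_repr {T : H →L[ℂ] H} {μ : ι → ℂ}
    (h : ∀ ξ i, b.repr (T ξ) i = μ i * b.repr ξ i) (hμ : Filter.Tendsto μ Filter.cofinite (nhds 0)) :
    IsCompactOperator T := by
  classical
  have hF : ∀ s : Finset ι, IsCompactOperator
      (∑ i ∈ s, (innerSL ℂ (b i)).smulRight (μ i • b i) : H →L[ℂ] H) := fun s => by
    have : ∑ i ∈ s, (innerSL ℂ (b i)).smulRight (μ i • b i) ∈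
        compactOperator (RingHom.id ℂ) H H := by
      refine Submodule.sum_mem _ fun i _ => ?_
      have h1 : IsCompactOperator (innerSL ℂ (b i)) :=
        isCompactOperator_of_locallyCompactSpace_dom (innerSL ℂ (b i))
      exact h1.clm_comp (ContinuousLinearMap.toSpanSingleton ℂ (μ i • b i))
    exact this
  refine isCompactOperator_of_tendsto (l := Filter.atTop) (F := fun s : Finset ι =>
    ∑ i ∈ s, (innerSL ℂ (b i)).smulRight (μ i • b i)) ?_ (Filter.Eventually.of_forall hF)
  rw [Metric.tendsto_atTop]
  intro ε hε
  have hfin : {i | ¬ ‖μ i‖ < ε / 2}.Finite := by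
    have := (tendsto_zero_iff_norm_tendsto_zero.1 hμ).eventually_lt_const (half_pos hε)
    exact this
  refine ⟨hfin.toFinset, fun s hs => ?_⟩
  obtain ⟨D, hD, hD'⟩ := exists_bounded_diagonal b (fun i => if i ∈ s then 0 else μ i) (ε / 2)
    (half_pos hε).le fun i => by
      split_ifs with hi
      · simpa using (half_pos hε).le
      · by_contra hlt
        exact hi (hs (hfin.mem_toFinset.2 fun h => hlt h.le))
  have hb : T - ∑ i ∈ s, (innerSL ℂ (b i)).smulRight (μ i • b i) = D := by
    refine ext_basis b fun i => ?_
    have ho := orthonormal_iff_ite.1 b.orthonormal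
    rw [sub_apply, apply_basis_of_repr b h, apply_basis_of_repr b hD']
    by_cases hi : i ∈ s <;> simp [ho, hi]
  rw [dist_comm, dist_eq_norm, hb]
  linarith

end Resolvent

/-! ### Functional calculus on eigenvectors, and traces -/

section Trace

variable {H : Type*} [NormedAddCommGroup H] [InnerProductSpace ℂ H] [CompleteSpace H]

/-- An eigenvalue lies in the spectrum, so evaluation there makes sense. The functions that act on
`v` by evaluation contain the constants and the identity, are stable under sums and products, and
form a closed set. -/
theorem cfc_apply_eigenvector {R : H →L[ℂ] H} (hR : IsSelfAdjoint R) {v : H} (hv : v ≠ 0) {a : ℝ}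
    (h : R v = (a : ℂ) • v) {f : ℝ → ℝ} (hf : Continuous f) : cfc f R v = (f a : ℂ) • v := by
  have ha : a ∈ spectrum ℝ R := by
    rw [spectrum.mem_iff]
    intro hu
    have h0 : (algebraMap ℝ (H →L[ℂ] H) a - R) v = 0 := by
      rw [sub_apply, h, Algebra.algebraMap_eq_smul_one]
      simp
    obtain ⟨w, hw⟩ := hu
    apply hv
    have : (↑w⁻¹ * (w : H →L[ℂ] H)) v = 0 := by
      rw [hw]
      change (↑w⁻¹ : H →L[ℂ] H) ((algebraMap ℝ (H →L[ℂ] H) a - R) v) = 0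
      rw [h0, map_zero]
    simpa using this
  rw [cfc_apply f R hR hf.continuousOn]
  have key : ∀ g : C(spectrum ℝ R, ℝ), cfcHom hR g v = (g ⟨a, ha⟩ : ℂ) • v := by
    intro g
    induction g using ContinuousMap.induction_on_of_compact with
    | const r =>
      have : ContinuousMap.const (spectrum ℝ R) r = algebraMap ℝ _ r := rfl
      rw [this, AlgHomClass.commutes, Algebra.algebraMap_eq_smul_one]
      simp
    | id =>
      rw [cfcHom_id, h]
      rfl
    | star_id =>
      rw [map_star, cfcHom_id, hR.star_eq, h]
      simp
    | add f g hf hg => simp [hf, hg, add_smul]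
    | mul f g hf hg =>
      rw [map_mul]
      change cfcHom hR f (cfcHom hR g v) = _
      rw [hg, map_smul, hf, smul_smul]
      simp [mul_comm]
    | frequently f hf =>
      have hcl : IsClosed {g : C(spectrum ℝ R, ℝ) | cfcHom hR g v = (g ⟨a, ha⟩ : ℂ) • v} := by
        refine isClosed_eq ?_ ?_
        · exact (ContinuousLinearMap.apply ℂ H v).continuous.comp (cfcHom_continuous hR)
        · fun_prop
      exact hcl.closure_subset (mem_closure_iff_frequently.2 hf)
  rw [key]
  rfl

variable {ι : Type*} (b : HilbertBasis ι ℂ H)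

theorem nonneg_of_repr {T : H →L[ℂ] H} {μ : ι → ℝ} (hμ : ∀ i, 0 ≤ μ i)
    (h : ∀ ξ i, b.repr (T ξ) i = (μ i : ℂ) * b.repr ξ i) : 0 ≤ T := by
  rw [ContinuousLinearMap.nonneg_iff_isPositive]
  refine ⟨fun x y => ?_, fun x => ?_⟩
  · change ⟪T x, y⟫_ℂ = ⟪x, T y⟫_ℂ
    rw [← b.repr.inner_map_map, ← b.repr.inner_map_map, lp.inner_eq_tsum, lp.inner_eq_tsum]
    congr 1
    funext i
    rw [h, h]
    simp only [RCLike.inner_apply, map_mul, Complex.conj_ofReal]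
    ring
  · rw [ContinuousLinearMap.reApplyInnerSelf_apply, ← b.repr.inner_map_map, lp.inner_eq_tsum,
      RCLike.re_tsum _ (lp.summable_inner _ _)]
    refine tsum_nonneg fun i => ?_
    rw [h]
    simp only [RCLike.inner_apply, map_mul, Complex.conj_ofReal]
    have : b.repr x i * ((μ i : ℂ) * (starRingEnd ℂ) (b.repr x i)) =
        ((μ i * Complex.normSq (b.repr x i) : ℝ) : ℂ) := by
      rw [mul_left_comm, Complex.mul_conj]
      push_cast
      rfl
    rw [this]
    exact mul_nonneg (hμ i) (Complex.normSq_nonneg _)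

theorem hasSum_norm_sq_repr (x : H) : HasSum (fun i => ‖⟪b i, x⟫_ℂ‖ ^ 2) (‖x‖ ^ 2) := by
  have h := lp.hasSum_norm (p := 2) (by norm_num) (b.repr x)
  simpa [b.repr_apply_apply] using h

/-- Independence of the trace from the basis: the double series `μ i * ‖⟪b i, d j⟫‖²` has row sums
`μ i` by Parseval and column sums the diagonal entries in the basis `d`. All terms are nonnegative,
so the order of summation may be exchanged. -/
theorem summable_inner_of_basis_eigen {T : H →L[ℂ] H} {μ : ι → ℝ} (hμ : ∀ i, 0 ≤ μ i)
    (h : ∀ i, T (b i) = (μ i : ℂ) • b i) (hs : Summable μ) {κ : Type*} (d : HilbertBasis κ ℂ H) :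
    Summable fun j => (⟪d j, T (d j)⟫_ℂ).re := by
  have e : ∀ j, HasSum (fun i => μ i * ‖⟪b i, d j⟫_ℂ‖ ^ 2) (⟪d j, T (d j)⟫_ℂ).re := by
    intro j
    have h1 := (b.hasSum_repr (d j)).mapL ((innerSL ℂ (d j)).comp T)
    have h2 := h1.mapL Complex.reCLM
    convert! h2 using 2 with i
    simp only [ContinuousLinearMap.comp_apply, map_smul, h, innerSL_apply_apply, b.repr_apply_apply,
      Complex.reCLM_apply]
    rw [← inner_conj_symm (d j) (b i)]
    have : ⟪b i, d j⟫_ℂ * ((μ i : ℂ) * (starRingEnd ℂ) ⟪b i, d j⟫_ℂ) =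
        ((μ i * ‖⟪b i, d j⟫_ℂ‖ ^ 2 : ℝ) : ℂ) := by
      rw [mul_left_comm, Complex.mul_conj, Complex.normSq_eq_norm_sq]
      push_cast
      rfl
    simp only [smul_eq_mul]
    rw [this, Complex.ofReal_re]
  have hrow : ∀ i, HasSum (fun j => μ i * ‖⟪b i, d j⟫_ℂ‖ ^ 2) (μ i) := by
    intro i
    have := (hasSum_norm_sq_repr d (b i)).mul_left (μ i)
    simp only [b.orthonormal.1 i, one_pow, mul_one] at this
    simpa [norm_inner_symm] using this
  have hsum : Summable fun p : ι × κ => μ p.1 * ‖⟪b p.1, d p.2⟫_ℂ‖ ^ 2 := by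
    rw [summable_prod_of_nonneg fun p => mul_nonneg (hμ _) (sq_nonneg _)]
    exact ⟨fun i => (hrow i).summable, by simpa only [(hrow _).tsum_eq] using hs⟩
  have hswap := hsum.prod_symm.prod
  simpa only [Prod.swap_prod_mk, (e _).tsum_eq] using hswap

theorem hasFiniteTrace_iff {T : H →L[ℂ] H} {μ : ι → ℝ} (hμ : ∀ i, 0 ≤ μ i)
    (h : ∀ i, T (b i) = (μ i : ℂ) • b i) : HasFiniteTrace T ↔ Summable μ := by
  refine ⟨fun hT => ?_, fun hs w d => summable_inner_of_basis_eigen b hμ h hs d⟩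
  -- `HasFiniteTrace` quantifies over bases indexed by subsets of `H`, so `b` is reindexed by its
  -- own range.
  have hinj : Function.Injective b := b.orthonormal.linearIndependent.injective
  let e : ι ≃ Set.range b := Equiv.ofInjective b hinj
  have ho : Orthonormal ℂ ((↑) : Set.range b → H) := b.orthonormal.toSubtypeRange
  let d : HilbertBasis (Set.range b) ℂ H :=
    HilbertBasis.mk ho (by rw [Subtype.range_coe, b.dense_span])
  have hd : ∀ j, d j = (j : H) := fun j => congrFun (HilbertBasis.coe_mk ho _) j
  have := (e.summable_iff).2 (hT _ d)
  refine this.congr fun i => ?_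
  have hi : d (e i) = b i := hd _
  simp only [Function.comp_apply, hi, h, inner_smul_right, inner_self_eq_norm_sq_to_K,
    b.orthonormal.1 i]
  simp

variable (c : ι → ℝ)

theorem summable_diagonal_iff {s : ℝ} (hs : 0 < s) :
    (∃ R : H →L[ℂ] H, IsInvOneAddSq (diagonalOp b c) R ∧ HasFiniteTrace (R ^ (s / 2))) ↔
      Summable fun i => (1 + c i ^ 2) ^ (-(s / 2)) := by
  obtain ⟨R, hR, hR'⟩ := exists_isInvOneAddSq b c
  have h0 : ∀ i, 0 ≤ (1 + c i ^ 2)⁻¹ := fun i => by positivity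
  have hnn := nonneg_of_repr b h0 hR'
  have heig : ∀ i, (R ^ (s / 2)) (b i) = (((1 + c i ^ 2) ^ (-(s / 2)) : ℝ) : ℂ) • b i := by
    intro i
    rw [CFC.rpow_eq_cfc_real hnn, cfc_apply_eigenvector (IsSelfAdjoint.of_nonneg hnn)
      (b.orthonormal.ne_zero i) (hR.apply_basis b c i)
      (Real.continuous_rpow_const (by positivity)), Real.inv_rpow (by positivity),
      Real.rpow_neg (by positivity)]
  have huniq : ∀ R', IsInvOneAddSq (diagonalOp b c) R' → R' = R := fun R' h' =>
    ext_basis b fun i => by rw [h'.apply_basis, hR.apply_basis]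
  rw [← hasFiniteTrace_iff b (fun i => by positivity) heig]
  constructor
  · rintro ⟨R', h', ht⟩
    rwa [huniq R' h'] at ht
  · exact fun h => ⟨R, hR, h⟩

end Trace

/-! ### Conjugation by the unitary flow of a diagonal operator -/

section Flow

variable {H : Type*} [NormedAddCommGroup H] [InnerProductSpace ℂ H] [CompleteSpace H]

theorem opNorm_le_of_norm_inner_le {D : Set H} (hD : Dense D) {A : H →L[ℂ] H} {C : ℝ} (hC : 0 ≤ C)
    (h : ∀ y ∈ D, ∀ x ∈ D, ‖⟪y, A x⟫_ℂ‖ ≤ C * (‖y‖ * ‖x‖)) : ‖A‖ ≤ C := by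
  have hcl : IsClosed {p : H × H | ‖⟪p.1, A p.2⟫_ℂ‖ ≤ C * (‖p.1‖ * ‖p.2‖)} :=
    isClosed_le (by fun_prop) (by fun_prop)
  have hall : ∀ p : H × H, ‖⟪p.1, A p.2⟫_ℂ‖ ≤ C * (‖p.1‖ * ‖p.2‖) := fun p => by
    have : D ×ˢ D ⊆ {p : H × H | ‖⟪p.1, A p.2⟫_ℂ‖ ≤ C * (‖p.1‖ * ‖p.2‖)} :=
      fun q hq => h q.1 hq.1 q.2 hq.2
    exact hcl.closure_subset_iff.2 this (by rw [(hD.prod hD).closure_eq]; trivial)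
  refine A.opNorm_le_bound hC fun x => ?_
  have h1 := hall (A x, x)
  simp only [inner_self_eq_norm_sq_to_K] at h1
  rcases (norm_nonneg (A x)).eq_or_lt with h0 | h0
  · rw [← h0]
    positivity
  · rw [norm_pow] at h1
    simp only [Complex.coe_algebraMap, Complex.norm_real, norm_norm] at h1
    nlinarith

variable {ι : Type*} (b : HilbertBasis ι ℂ H) (c : ι → ℝ)

/-- This replaces unitarity of `e^{-itD}`: only finite combinations of basis vectors are ever moved,
so the unitary group need not be constructed. -/
theorem norm_sum_phase (s : Finset ι) (x φ : ι → ℂ) (hφ : ∀ i, ‖φ i‖ = 1) :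
    ‖∑ i ∈ s, (φ i * x i) • b i‖ = ‖∑ i ∈ s, x i • b i‖ := by
  have e : ∀ z : ι → ℂ, ‖∑ i ∈ s, z i • b i‖ ^ 2 = ∑ i ∈ s, ‖z i‖ ^ 2 := fun z => by
    have := b.orthonormal.inner_sum z z s
    rw [inner_self_eq_norm_sq_to_K] at this
    have h2 : ∑ i ∈ s, (starRingEnd ℂ) (z i) * z i = ((∑ i ∈ s, ‖z i‖ ^ 2 : ℝ) : ℂ) := by
      push_cast
      exact Finset.sum_congr rfl fun i _ => by
        rw [mul_comm, Complex.mul_conj, Complex.normSq_eq_norm_sq]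
        push_cast
        rfl
    rw [h2] at this
    refine Complex.ofReal_injective (Eq.trans ?_ this)
    push_cast
    rfl
  rw [← sq_eq_sq₀ (norm_nonneg _) (norm_nonneg _), e, e]
  simp [hφ]

theorem inner_sum_sum (s : Finset ι) (y x : ι → ℂ) (T : H →L[ℂ] H) :
    ⟪∑ n ∈ s, y n • b n, T (∑ k ∈ s, x k • b k)⟫_ℂ =
      ∑ n ∈ s, ∑ k ∈ s, (starRingEnd ℂ) (y n) * x k * ⟪b n, T (b k)⟫_ℂ := by
  rw [sum_inner, map_sum]
  refine Finset.sum_congr rfl fun n _ => ?_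
  rw [inner_sum]
  refine Finset.sum_congr rfl fun k _ => ?_
  rw [map_smul, inner_smul_left, inner_smul_right]
  ring

/-- If `[D, S]` is bounded by `‖B‖`, then `e^{iτD} S e^{-iτD} - S` is bounded by `|τ| ‖B‖`. -/
theorem norm_le_of_exp_matrix {S B A : H →L[ℂ] H} {τ : ℝ}
    (hB : ∀ n k, ⟪b n, B (b k)⟫_ℂ = (c n - c k) * ⟪b n, S (b k)⟫_ℂ)
    (hA : ∀ n k, ⟪b n, A (b k)⟫_ℂ =
      (Complex.exp (Complex.I * τ * (c n - c k)) - 1) * ⟪b n, S (b k)⟫_ℂ) :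
    ‖A‖ ≤ |τ| * ‖B‖ := by
  have main : ∀ (s : Finset ι) (y x : ι → ℂ),
      ‖⟪∑ n ∈ s, y n • b n, A (∑ k ∈ s, x k • b k)⟫_ℂ‖ ≤
        |τ| * ‖B‖ * (‖∑ n ∈ s, y n • b n‖ * ‖∑ k ∈ s, x k • b k‖) := by
    intro s y x
    -- `F t` is `⟪y, e^{itD} S e^{-itD} x⟫` for finite combinations `x` and `y`. Its derivative is
    -- `i ⟪e^{-itD} y, B e^{-itD} x⟫`, of modulus at most `‖B‖ ‖y‖ ‖x‖`, and the mean value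
    -- inequality on `[0, τ]` concludes.
    let F : ℝ → ℂ := fun t => ∑ n ∈ s, ∑ k ∈ s, (starRingEnd ℂ) (y n) * x k *
      (Complex.exp (Complex.I * t * (c n - c k)) * ⟪b n, S (b k)⟫_ℂ)
    let φ : ℝ → ι → ℂ := fun t n => Complex.exp ((-t * c n : ℝ) * Complex.I)
    have hφ : ∀ t n, ‖φ t n‖ = 1 := fun t n => Complex.norm_exp_ofReal_mul_I _
    have hconj : ∀ t n, (starRingEnd ℂ) (φ t n) = Complex.exp (Complex.I * t * c n) := by
      intro t n
      simp only [φ]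
      rw [← Complex.exp_conj]
      congr 1
      simp
      ring
    have hF' : ∀ t : ℝ, HasDerivAt F (Complex.I * ⟪∑ n ∈ s, (φ t n * y n) • b n,
        B (∑ k ∈ s, (φ t k * x k) • b k)⟫_ℂ) t := by
      intro t
      rw [inner_sum_sum, Finset.mul_sum]
      refine HasDerivAt.fun_sum fun n _ => ?_
      rw [Finset.mul_sum]
      refine HasDerivAt.fun_sum fun k _ => ?_
      have h1 : HasDerivAt (fun t : ℝ => Complex.I * (t : ℂ) * ((c n : ℂ) - c k))
          (Complex.I * 1 * (c n - c k)) t :=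
        ((Complex.ofRealCLM.hasDerivAt (x := t)).const_mul Complex.I).mul_const _
      have h2 := ((h1.cexp).mul_const ⟪b n, S (b k)⟫_ℂ).const_mul ((starRingEnd ℂ) (y n) * x k)
      convert! h2 using 1
      rw [hB, map_mul, hconj]
      have : Complex.exp (Complex.I * t * (c n - c k)) =
          Complex.exp (Complex.I * t * c n) * φ t k := by
        simp only [φ]
        rw [← Complex.exp_add]
        congr 1
        push_cast
        ring
      rw [this]
      ring
    have hbound : ∀ t ∈ (univ : Set ℝ), ‖Complex.I * ⟪∑ n ∈ s, (φ t n * y n) • b n,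
        B (∑ k ∈ s, (φ t k * x k) • b k)⟫_ℂ‖ ≤
          ‖B‖ * (‖∑ n ∈ s, y n • b n‖ * ‖∑ k ∈ s, x k • b k‖) := by
      intro t _
      rw [norm_mul, Complex.norm_I, one_mul, ← norm_sum_phase b s y (φ t) (hφ t),
        ← norm_sum_phase b s x (φ t) (hφ t)]
      refine (norm_inner_le_norm _ _).trans ?_
      have := B.le_opNorm (∑ k ∈ s, (φ t k * x k) • b k)
      calc _ ≤ ‖∑ n ∈ s, (φ t n * y n) • b n‖ * (‖B‖ * ‖∑ k ∈ s, (φ t k * x k) • b k‖) := by gcongr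
        _ = _ := by ring
    have hmv := convex_univ.norm_image_sub_le_of_norm_hasDerivWithin_le
      (fun t _ => (hF' t).hasDerivWithinAt) hbound (mem_univ 0) (mem_univ τ)
    have hdiff : F τ - F 0 = ⟪∑ n ∈ s, y n • b n, A (∑ k ∈ s, x k • b k)⟫_ℂ := by
      rw [inner_sum_sum]
      simp only [F, ← Finset.sum_sub_distrib]
      refine Finset.sum_congr rfl fun n _ => Finset.sum_congr rfl fun k _ => ?_
      rw [hA]
      simp
      ring
    rw [hdiff, sub_zero, Real.norm_eq_abs] at hmv
    linarith
  refine opNorm_le_of_norm_inner_le (dense_span_basis b) (by positivity) ?_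
  classical
  intro y hy x hx
  obtain ⟨y, rfl⟩ := (Finsupp.mem_span_range_iff_exists_finsupp).1 hy
  obtain ⟨x, rfl⟩ := (Finsupp.mem_span_range_iff_exists_finsupp).1 hx
  -- Both sums are extended by zero to the union of the supports, since `main` uses one index set
  -- for both.
  rw [Finsupp.sum_of_support_subset y (Finset.subset_union_left (s₂ := x.support)) _ (by simp),
    Finsupp.sum_of_support_subset x (Finset.subset_union_right (s₁ := y.support)) _ (by simp)]
  exact main _ y x

end Flow

/-! ### Bases, operators and commutators of direct sums -/

section Sum

variable {ι κ : Type*} {H : ι → Type*} [∀ i, NormedAddCommGroup (H i)]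
  [∀ i, InnerProductSpace ℂ (H i)] [∀ i, CompleteSpace (H i)]

open scoped Classical in
theorem exists_prod_basis (b : ∀ i, HilbertBasis κ ℂ (H i)) :
    ∃ d : HilbertBasis (ι × κ) ℂ (lp H 2), ∀ i k, d (i, k) = lp.single 2 i (b i k) := by
  have ho : Orthonormal ℂ fun q : ι × κ => (lp.single 2 q.1 (b q.1 q.2) : lp H 2) := by
    rw [orthonormal_iff_ite]
    rintro ⟨i, k⟩ ⟨j, l⟩
    rw [lp.inner_single_left]
    by_cases hij : i = j
    · subst hij
      simp [orthonormal_iff_ite.1 (b i).orthonormal k l]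
    · simp [hij]
  refine ⟨HilbertBasis.mkOfOrthogonalEqBot ho ?_, fun i k => by
    rw [HilbertBasis.coe_mkOfOrthogonalEqBot]⟩
  rw [Submodule.eq_bot_iff]
  intro ξ hξ
  rw [Submodule.mem_orthogonal] at hξ
  refine lp.ext (funext fun i => ext_repr (b i) fun k => ?_)
  have := hξ _ (Submodule.subset_span ⟨(i, k), rfl⟩)
  rw [lp.inner_single_left] at this
  rw [(b i).repr_apply_apply, this]
  simp

noncomputable def prodBasis (b : ∀ i, HilbertBasis κ ℂ (H i)) : HilbertBasis (ι × κ) ℂ (lp H 2) :=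
  (exists_prod_basis b).choose

variable (b : ∀ i, HilbertBasis κ ℂ (H i))

open scoped Classical in
theorem prodBasis_apply (i : ι) (k : κ) : prodBasis b (i, k) = lp.single 2 i (b i k) :=
  (exists_prod_basis b).choose_spec i k

theorem prodBasis_repr (ξ : lp H 2) (q : ι × κ) :
    (prodBasis b).repr ξ q = (b q.1).repr (ξ q.1) q.2 := by
  classical
  rw [HilbertBasis.repr_apply_apply, show q = (q.1, q.2) from rfl, prodBasis_apply,
    lp.inner_single_left, HilbertBasis.repr_apply_apply]

/-- Both operators are block diagonal: between different summands both matrix entries vanish,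
whatever the difference of the eigenvalues. -/
theorem isCommutator_prodBasis {c : ι → κ → ℝ} {S B : ∀ i, H i →L[ℂ] H i} {C C' : ℝ}
    {hC : 0 ≤ C} {hC' : 0 ≤ C'} {hS : ∀ i, ‖S i‖ ≤ C} {hB : ∀ i, ‖B i‖ ≤ C'}
    (h : ∀ i n k, ⟪b i n, B i (b i k)⟫_ℂ = (c i n - c i k) * ⟪b i n, S i (b i k)⟫_ℂ) :
    IsCommutator (diagonalOp (prodBasis b) fun q => c q.1 q.2) (sumCLM S C hC hS)
      (sumCLM B C' hC' hB) := by
  classical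
  rw [isCommutator_diagonalOp_iff]
  rintro ⟨i, n⟩ ⟨j, k⟩
  rw [prodBasis_apply, prodBasis_apply, lp.inner_single_left, lp.inner_single_left, sumCLM_apply,
    sumCLM_apply]
  by_cases hij : i = j
  · subst hij
    rw [lp.single_apply_self, h]
  · rw [lp.single_apply_ne _ _ _ hij, map_zero, map_zero, inner_zero_right, mul_zero]

/-- An arbitrary bounded commutator is not assumed block diagonal. Its compression to one summand
has the required entries, and the norm does not grow because inclusion and evaluation are
contractions. -/
theorem exists_component_of_isCommutator {c : ι → κ → ℝ} {S : ∀ i, H i →L[ℂ] H i} {C : ℝ}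
    {hC : 0 ≤ C} {hS : ∀ i, ‖S i‖ ≤ C} {B : lp H 2 →L[ℂ] lp H 2}
    (h : IsCommutator (diagonalOp (prodBasis b) fun q => c q.1 q.2) (sumCLM S C hC hS) B) (i : ι) :
    ∃ B' : H i →L[ℂ] H i, ‖B'‖ ≤ ‖B‖ ∧
      ∀ n k, ⟪b i n, B' (b i k)⟫_ℂ = (c i n - c i k) * ⟪b i n, S i (b i k)⟫_ℂ := by
  classical
  rw [isCommutator_diagonalOp_iff] at h
  refine ⟨(lp.evalCLM ℂ H 2 i).comp (B.comp (lp.singleContinuousLinearMap ℂ H 2 i)), ?_,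
    fun n k => ?_⟩
  · refine ContinuousLinearMap.opNorm_le_bound _ (norm_nonneg _) fun x => ?_
    change ‖B (lp.single 2 i x) i‖ ≤ _
    refine (lp.norm_apply_le_norm two_ne_zero _ i).trans ((B.le_opNorm _).trans_eq ?_)
    rw [lp.norm_single (by norm_num)]
  · have := h (i, n) (i, k)
    rw [prodBasis_apply, prodBasis_apply, lp.inner_single_left, lp.inner_single_left, sumCLM_apply,
      lp.single_apply_self] at this
    exact this

/-- Both domains are maximal: each asks that the rescaled coordinates be those of a vector of the
whole direct sum, and in either direction the image vector is the witness. -/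
theorem sumPMap_diagonalOp (c : ι → κ → ℝ) :
    sumPMap (fun i => diagonalOp (b i) (c i)) =
      diagonalOp (prodBasis b) fun q => c q.1 q.2 := by
  have key : ∀ (ξ : (sumPMap fun i => diagonalOp (b i) (c i)).domain) (q : ι × κ),
      (prodBasis b).repr (sumPMap (fun i => diagonalOp (b i) (c i)) ξ) q =
        (c q.1 q.2 : ℂ) * (prodBasis b).repr ξ q := by
    intro ξ q
    rw [prodBasis_repr, prodBasis_repr]
    exact repr_diagonalOp (b q.1) (c q.1) ⟨(ξ : lp H 2) q.1, ξ.2.choose q.1⟩ q.2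
  refine LinearPMap.ext (SetLike.ext fun ξ => ⟨fun h => ?_, fun h => ?_⟩) ?_
  · exact mem_diagonalOp_domain_of_repr _ _ (key ⟨ξ, h⟩)
  · set η := diagonalOp (prodBasis b) (fun q => c q.1 q.2) ⟨ξ, h⟩ with hη
    have e : ∀ i k, (b i).repr (η i) k = c i k * (b i).repr (ξ i) k := fun i k => by
      have := repr_diagonalOp (prodBasis b) (fun q => c q.1 q.2) ⟨ξ, h⟩ (i, k)
      rwa [prodBasis_repr, prodBasis_repr] at this
    refine ⟨fun i => mem_diagonalOp_domain_of_repr (b i) (c i) (e i), ?_⟩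
    have : (fun i => diagonalOp (b i) (c i)
        ⟨ξ i, mem_diagonalOp_domain_of_repr (b i) (c i) (e i)⟩) = fun i => η i :=
      funext fun i => diagonalOp_eq_of_repr (b i) (c i) (e i)
    rw [this]
    exact lp.memℓp η
  · intro ξ h1 h2
    exact (diagonalOp_eq_of_repr _ _ (key ⟨ξ, h1⟩)).symm

end Sum

/-! ### Norms of multiplication operators -/

section Multiplication

variable {X : Type*} [MeasurableSpace X] {μ : Measure X}

/-- Multiplication by a bounded function on `L²`. -/
noncomputable def mulLp (g : X → ℂ) (hg : MemLp g ∞ μ) : Lp ℂ 2 μ →L[ℂ] Lp ℂ 2 μ :=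
  (ContinuousLinearMap.mul ℂ ℂ).holderL μ ∞ 2 2 hg.toLp

theorem coeFn_mulLp (g : X → ℂ) (hg : MemLp g ∞ μ) (ξ : Lp ℂ 2 μ) :
    mulLp g hg ξ =ᵐ[μ] fun t => g t * ξ t := by
  have h1 := (ContinuousLinearMap.mul ℂ ℂ).coeFn_holder (r := 2) hg.toLp ξ
  filter_upwards [h1, hg.coeFn_toLp] with t h1 h2
  rw [← h2]
  exact h1

theorem norm_mulLp_le {g : X → ℂ} (hg : MemLp g ∞ μ) {C : ℝ} (hC : 0 ≤ C) (h : ∀ x, ‖g x‖ ≤ C) :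
    ‖mulLp g hg‖ ≤ C := by
  refine ContinuousLinearMap.opNorm_le_bound _ hC fun ξ => ?_
  refine Lp.norm_le_mul_norm_of_ae_le_mul ?_
  filter_upwards [coeFn_mulLp g hg ξ] with t ht
  rw [ht, norm_mul]
  exact mul_le_mul_of_nonneg_right (h t) (norm_nonneg _)

/-- Were the set where `C' < ‖g‖` not null, its indicator would be stretched by at least `C'`, which
exceeds the operator norm. -/
theorem ae_norm_le_of_norm_mulLp_le [IsFiniteMeasure μ] {g : X → ℂ} (hm : Measurable g)
    (hg : MemLp g ∞ μ) {C C' : ℝ} (hC : 0 ≤ C) (hCC : C < C') (h : ‖mulLp g hg‖ ≤ C) :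
    ∀ᵐ x ∂μ, ‖g x‖ ≤ C' := by
  have hU : MeasurableSet {x | C' < ‖g x‖} := measurableSet_lt measurable_const hm.norm
  by_contra hne
  have hμ : μ {x | C' < ‖g x‖} ≠ 0 := by
    rw [ae_iff] at hne
    simpa only [not_le] using hne
  set ξ : Lp ℂ 2 μ := indicatorConstLp 2 hU (measure_ne_top μ _) (1 : ℂ) with hξ
  have hpos : 0 < ‖ξ‖ := by
    rw [hξ, norm_indicatorConstLp two_ne_zero (by norm_num), norm_one, one_mul]
    refine Real.rpow_pos_of_pos ?_ _
    exact ENNReal.toReal_pos hμ (measure_ne_top μ _)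
  have h1 : ‖(C' : ℂ) • ξ‖ ≤ ‖mulLp g hg ξ‖ := by
    refine Lp.norm_le_norm_of_ae_le ?_
    filter_upwards [coeFn_mulLp g hg ξ, Lp.coeFn_smul (C' : ℂ) ξ,
      indicatorConstLp_coeFn (p := 2) (hs := hU) (hμs := measure_ne_top μ _) (c := (1 : ℂ))]
      with t h1 h2 h3
    rw [h1, h2, Pi.smul_apply, smul_eq_mul, norm_mul, norm_mul, hξ, h3]
    by_cases ht : t ∈ {x | C' < ‖g x‖}
    · have : C' < ‖g t‖ := ht
      simp only [indicator_of_mem ht, norm_one, mul_one, Complex.norm_real, Real.norm_eq_abs,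
        abs_of_pos (hC.trans_lt hCC)]
      exact this.le
    · simp only [indicator_of_notMem ht, norm_zero, mul_zero, le_refl]
  have h2 := (mulLp g hg).le_of_opNorm_le h ξ
  rw [norm_smul, Complex.norm_real, Real.norm_eq_abs, abs_of_pos (hC.trans_lt hCC)] at h1
  nlinarith

end Multiplication

/-! ### The interval triple: commutators and Lipschitz constants -/

section Interval

variable {α : ℝ}

theorem integral_intervalMeasure (hα : 0 < α) (f : ℝ → ℂ) :
    ∫ x, f x ∂intervalMeasure α = ((2 * α)⁻¹ : ℝ) • ∫ x in -α..α, f x := by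
  rw [intervalMeasure, integral_smul_measure, intervalIntegral.integral_of_le (by linarith),
    integral_Icc_eq_integral_Ioc, ENNReal.toReal_inv, ENNReal.toReal_ofReal (by positivity)]

theorem isFiniteMeasure_intervalMeasure (hα : 0 < α) : IsFiniteMeasure (intervalMeasure α) := by
  refine ⟨?_⟩
  rw [intervalMeasure, Measure.smul_apply, smul_eq_mul]
  refine ENNReal.mul_lt_top (ENNReal.inv_lt_top.2 (ENNReal.ofReal_pos.2 (by positivity))) ?_
  rw [Measure.restrict_apply_univ]
  exact isCompact_Icc.measure_lt_top

theorem norm_le_of_norm_mulLp_le (hα : 0 < α) {g : ℝ → ℂ} (hc : Continuous g)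
    (hg : MemLp g ∞ (intervalMeasure α)) {C : ℝ} (hC : 0 ≤ C) (h : ‖mulLp g hg‖ ≤ C) {t : ℝ}
    (ht : t ∈ Icc (-α) α) : ‖g t‖ ≤ C := by
  have := isFiniteMeasure_intervalMeasure hα
  refine le_of_forall_gt_imp_ge_of_dense fun C' hC' => ?_
  have h1 := ae_norm_le_of_norm_mulLp_le hc.measurable hg hC hC' h
  replace h1 : ∀ᵐ x ∂volume.restrict (Icc (-α) α), ‖g x‖ ≤ C' := by
    rw [intervalMeasure, ae_iff, Measure.smul_apply, smul_eq_mul, mul_eq_zero] at h1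
    exact h1.resolve_left (ENNReal.inv_ne_zero.2 ENNReal.ofReal_ne_top)
  -- The passage from almost everywhere to everywhere is for equalities of continuous functions, so
  -- `‖g x‖ ≤ C'` is encoded as `max ‖g x‖ C' = C'`.
  have h2 : (fun x => max ‖g x‖ C') =ᵐ[volume.restrict (Icc (-α) α)] fun _ => C' := by
    filter_upwards [h1] with x hx
    exact max_eq_right hx
  have h3 := Measure.eqOn_Icc_of_ae_eq volume (by linarith) h2 (by fun_prop) (by fun_prop) ht
  exact max_eq_right_iff.1 h3

theorem inner_intervalBasis_mulLp (hα : 0 < α) {g : ℝ → ℂ} (hg : MemLp g ∞ (intervalMeasure α))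
    (n k : ℤ) : ⟪intervalBasis hα n, mulLp g hg (intervalBasis hα k)⟫_ℂ =
      ∫ x, g x * Complex.exp (Complex.I * Real.pi * (k - n) * x / α) ∂intervalMeasure α := by
  rw [L2.inner_def]
  refine integral_congr_ae ?_
  filter_upwards [coeFn_mulLp g hg (intervalBasis hα k), coeFn_intervalBasis hα n,
    coeFn_intervalBasis hα k] with x h1 h2 h3
  rw [h1, h2, h3, RCLike.inner_apply, ← Complex.exp_conj, mul_assoc, ← Complex.exp_add]
  congr 2
  simp
  ring

/-- The Fourier coefficients of the derivative of `t ↦ a + ε |t|`. -/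
theorem integral_derivative_even_affine (hα : 0 < α) (a : ℂ) (ε ω : ℝ)
    (hω : Complex.exp (Complex.I * ω * α) = Complex.exp (Complex.I * ω * (-α))) :
    ∫ x in -α..α, (-Complex.I * ε * (if x ≤ 0 then -1 else 1)) * Complex.exp (Complex.I * ω * x) =
      -ω * ∫ x in -α..α, (a + ε * (|x| : ℝ)) * Complex.exp (Complex.I * ω * x) := by
  -- Integration by parts on a half interval, where the function is `a + δ x` with `δ = -ε` on the
  -- left and `δ = ε` on the right.
  have hftc : ∀ (δ : ℂ) (r s : ℝ), ∫ x in r..s, (δ * Complex.exp (Complex.I * ω * x) +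
      (a + δ * x) * (Complex.exp (Complex.I * ω * x) * (Complex.I * ω))) =
      (a + δ * s) * Complex.exp (Complex.I * ω * s) -
        (a + δ * r) * Complex.exp (Complex.I * ω * r) := by
    intro δ r s
    have j : IntervalIntegrable (fun x : ℝ => δ * Complex.exp (Complex.I * ω * x) +
        (a + δ * x) * (Complex.exp (Complex.I * ω * x) * (Complex.I * ω))) volume r s :=
      Continuous.intervalIntegrable (by fun_prop) _ _
    refine intervalIntegral.integral_eq_sub_of_hasDerivAt
      (f := fun x : ℝ => (a + δ * x) * Complex.exp (Complex.I * ω * x)) (fun x _ => ?_) j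
    have h1 : HasDerivAt (fun x : ℝ => Complex.I * ω * (x : ℂ)) (Complex.I * ω) x := by
      simpa using (Complex.ofRealCLM.hasDerivAt (x := x)).const_mul (Complex.I * ω)
    have h2 : HasDerivAt (fun x : ℝ => a + δ * (x : ℂ)) δ x := by
      simpa using ((Complex.ofRealCLM.hasDerivAt (x := x)).const_mul δ).const_add a
    exact h2.mul h1.cexp
  have hsplit : ∀ (δ : ℂ) (r s : ℝ), ∫ x in r..s, (δ * Complex.exp (Complex.I * ω * x) +
      (a + δ * x) * (Complex.exp (Complex.I * ω * x) * (Complex.I * ω))) =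
      (∫ x in r..s, δ * Complex.exp (Complex.I * ω * x)) +
        Complex.I * ω * ∫ x in r..s, (a + δ * x) * Complex.exp (Complex.I * ω * x) := by
    intro δ r s
    have j1 : IntervalIntegrable (fun x : ℝ => δ * Complex.exp (Complex.I * ω * x)) volume r s :=
      Continuous.intervalIntegrable (by fun_prop) _ _
    have j2 : IntervalIntegrable (fun x : ℝ => (a + δ * x) *
        (Complex.exp (Complex.I * ω * x) * (Complex.I * ω))) volume r s :=
      Continuous.intervalIntegrable (by fun_prop) _ _
    rw [intervalIntegral.integral_add j1 j2, ← intervalIntegral.integral_const_mul]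
    congr 2
    funext x
    ring
  have e1 : EqOn (fun x : ℝ => (-Complex.I * ε * (if x ≤ 0 then -1 else 1)) *
      Complex.exp (Complex.I * ω * x)) (fun x : ℝ => -Complex.I *
        ((-ε : ℂ) * Complex.exp (Complex.I * ω * x))) (uIoc (-α) 0) := by
    intro x hx
    rw [uIoc_of_le (by linarith)] at hx
    simp only [if_pos hx.2]
    ring
  have e2 : EqOn (fun x : ℝ => (-Complex.I * ε * (if x ≤ 0 then -1 else 1)) *
      Complex.exp (Complex.I * ω * x)) (fun x : ℝ => -Complex.I *
        ((ε : ℂ) * Complex.exp (Complex.I * ω * x))) (uIoc 0 α) := by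
    intro x hx
    rw [uIoc_of_le (by linarith)] at hx
    simp only [if_neg (not_le.2 hx.1)]
    ring
  have e3 : EqOn (fun x : ℝ => (a + ε * (|x| : ℝ)) * Complex.exp (Complex.I * ω * x))
      (fun x : ℝ => (a + (-ε) * x) * Complex.exp (Complex.I * ω * x)) (uIoc (-α) 0) := by
    intro x hx
    rw [uIoc_of_le (by linarith)] at hx
    simp only [abs_of_nonpos hx.2]
    push_cast
    ring
  have e4 : EqOn (fun x : ℝ => (a + ε * (|x| : ℝ)) * Complex.exp (Complex.I * ω * x))
      (fun x : ℝ => (a + ε * x) * Complex.exp (Complex.I * ω * x)) (uIoc 0 α) := by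
    intro x hx
    rw [uIoc_of_le (by linarith)] at hx
    simp only [abs_of_pos hx.1]
  have i1 : ∀ (z : ℂ) (r s : ℝ), IntervalIntegrable (fun x : ℝ => -Complex.I *
      (z * Complex.exp (Complex.I * ω * x))) volume r s := fun z r s =>
    Continuous.intervalIntegrable (by fun_prop) _ _
  have i2 : ∀ (r s : ℝ), IntervalIntegrable (fun x : ℝ =>
      (a + ε * (|x| : ℝ)) * Complex.exp (Complex.I * ω * x)) volume r s := fun r s =>
    Continuous.intervalIntegrable (by fun_prop) _ _
  rw [← intervalIntegral.integral_add_adjacent_intervals (b := 0)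
      ((i1 _ _ _).congr e1.symm) ((i1 _ _ _).congr e2.symm),
    ← intervalIntegral.integral_add_adjacent_intervals (b := 0) (i2 _ _) (i2 _ _),
    intervalIntegral.integral_congr_ae (Filter.Eventually.of_forall e1),
    intervalIntegral.integral_congr_ae (Filter.Eventually.of_forall e2),
    intervalIntegral.integral_congr_ae (Filter.Eventually.of_forall e3),
    intervalIntegral.integral_congr_ae (Filter.Eventually.of_forall e4),
    intervalIntegral.integral_const_mul (-Complex.I),
    intervalIntegral.integral_const_mul (-Complex.I)]
  have h1 := hftc (-ε) (-α) 0
  have h2 := hftc ε 0 α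
  rw [hsplit] at h1 h2
  push_cast at h1 h2
  rw [← hω] at h1
  simp only [mul_zero, Complex.exp_zero] at h1 h2
  -- In `h1 + h2` the boundary terms cancel: at `0` because `|x|` is continuous, at `±α` because
  -- `|x|` is even and `hω` makes the exponentials agree.
  linear_combination (-Complex.I) * (h1 + h2) + (ω * ((∫ x in -α..0, (a + (-ε) * x) *
    Complex.exp (Complex.I * ω * x)) + ∫ x in (0:ℝ)..α, (a + ε * x) *
    Complex.exp (Complex.I * ω * x))) * Complex.I_sq

/-- As `D` is `-i d/dx` with periodic boundary conditions, the commutator is multiplication by `-i`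
times the derivative of the even extension, here `-i ε` times the sign of `x`. -/
theorem exists_commutator_of_affine (hα : 0 < α) (f : C(Icc (0 : ℝ) α, ℂ)) (a : ℂ) {ε : ℝ}
    (hε : |ε| ≤ 1) (hf : ∀ t : Icc (0 : ℝ) α, f t = a + ε * (t : ℝ)) :
    ∃ B : IntervalL2 α →L[ℂ] IntervalL2 α, ‖B‖ ≤ 1 ∧ ∀ n k : ℤ,
      ⟪intervalBasis hα n, B (intervalBasis hα k)⟫_ℂ =
        (((Real.pi * n / α : ℝ) : ℂ) - ((Real.pi * k / α : ℝ) : ℂ)) *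
          ⟪intervalBasis hα n, mulOp hα f (intervalBasis hα k)⟫_ℂ := by
  have hα' : (α : ℂ) ≠ 0 := by exact_mod_cast hα.ne'
  let g : ℝ → ℂ := fun x => -Complex.I * ε * (if x ≤ 0 then -1 else 1)
  have hb : ∀ x, ‖g x‖ ≤ 1 := fun x => by
    simp only [g, norm_mul, norm_neg, Complex.norm_I, one_mul, Complex.norm_real]
    split_ifs <;> simpa using hε
  have hm : Measurable g := by
    refine measurable_const.mul (Measurable.ite measurableSet_Iic measurable_const measurable_const)
  have hg : MemLp g ∞ (intervalMeasure α) :=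
    memLp_top_of_bound hm.aestronglyMeasurable 1 (Filter.Eventually.of_forall hb)
  refine ⟨mulLp g hg, norm_mulLp_le hg zero_le_one hb, fun n k => ?_⟩
  change _ = _ * ⟪intervalBasis hα n, mulLp (evenExtension hα f) (memLp_evenExtension hα f)
    (intervalBasis hα k)⟫_ℂ
  rw [inner_intervalBasis_mulLp, inner_intervalBasis_mulLp, integral_intervalMeasure hα,
    integral_intervalMeasure hα]
  -- The inner product conjugates `e_n`, so the frequency is the one of `k - n`, and `-ω` is the
  -- difference of the eigenvalues at `n` and `k`.
  set ω : ℝ := Real.pi * (k - n) / α with hω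
  have hexp : ∀ x : ℝ, Complex.exp (Complex.I * Real.pi * (k - n) * x / α) =
      Complex.exp (Complex.I * ω * x) := fun x => by
    rw [hω]
    congr 1
    push_cast
    ring
  have hper : Complex.exp (Complex.I * ω * α) = Complex.exp (Complex.I * ω * (-α)) := by
    rw [Complex.exp_eq_exp_iff_exists_int]
    refine ⟨k - n, ?_⟩
    rw [hω]
    push_cast
    field_simp
    ring
  have heven : EqOn (fun x : ℝ => evenExtension hα f x * Complex.exp (Complex.I * ω * x))
      (fun x : ℝ => (a + ε * (|x| : ℝ)) * Complex.exp (Complex.I * ω * x)) (uIoc (-α) α) := by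
    intro x hx
    rw [uIoc_of_le (by linarith)] at hx
    have : evenExtension hα f x = f (projIcc 0 α hα.le |x|) := rfl
    simp only [this]
    rw [projIcc_of_mem hα.le ⟨abs_nonneg x, abs_le.2 ⟨hx.1.le, hx.2⟩⟩, hf]
  simp only [hexp]
  rw [integral_derivative_even_affine hα a ε ω hper,
    intervalIntegral.integral_congr_ae (Filter.Eventually.of_forall heven), Complex.real_smul,
    Complex.real_smul, hω]
  push_cast
  field_simp
  ring

theorem integral_circle_translate [Fact (0 < 2 * α)] (Φ : C(AddCircle (2 * α), ℂ)) (τ : ℝ) (m : ℤ) :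
    ∫ x, Φ (x + (τ : AddCircle (2 * α))) * fourier m x ∂AddCircle.haarAddCircle =
      Complex.exp (-(Complex.I * Real.pi * m * τ / α)) *
        ∫ x, Φ x * fourier m x ∂AddCircle.haarAddCircle := by
  have hT : (0 : ℝ) < 2 * α := Fact.out
  have hα : (α : ℂ) ≠ 0 := by
    have : α ≠ 0 := by rintro rfl; simp at hT
    exact_mod_cast this
  rw [← integral_add_right_eq_self (fun x => Φ x * fourier m x) (τ : AddCircle (2 * α)),
    ← integral_const_mul]
  congr 1
  funext x
  have : fourier m (x + (τ : AddCircle (2 * α))) = fourier m x *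
      (fourier m (τ : AddCircle (2 * α)) : ℂ) := by
    simp only [fourier_apply, smul_add, AddCircle.toCircle_add, Circle.coe_mul]
  rw [this, fourier_coe_apply]
  have h2 : Complex.exp (-(Complex.I * Real.pi * m * τ / α)) *
      Complex.exp (2 * Real.pi * Complex.I * m * τ / ((2 * α : ℝ) : ℂ)) = 1 := by
    rw [← Complex.exp_add, Complex.exp_eq_one_iff]
    refine ⟨0, ?_⟩
    push_cast
    field_simp
    ring
  linear_combination (-(Φ (x + (τ : AddCircle (2 * α))) * fourier m x)) * h2

/-- The function `x ↦ f |x|`, seen on the circle of length `2 α`. -/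
noncomputable def circleExtension (hα : 0 < α) (f : C(Icc (0 : ℝ) α, ℂ)) : C(AddCircle (2 * α), ℂ) :=
  ⟨fun x => f (projIcc 0 α hα.le ‖x‖), f.continuous.comp (continuous_projIcc.comp continuous_norm)⟩

/-- The norm on the circle of length `2 α` is the distance to `0`, equal to `|x|` as long as `|x| ≤
α`; this makes the even extension a continuous function on the circle. -/
theorem circleExtension_coe (hα : 0 < α) (f : C(Icc (0 : ℝ) α, ℂ)) {x : ℝ}
    (hx : x ∈ Icc (-α) α) :
    circleExtension hα f (x : AddCircle (2 * α)) = evenExtension hα f x := by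
  have h2 : (0 : ℝ) < 2 * α := by positivity
  have : ‖(x : AddCircle (2 * α))‖ = |x| := by
    refine (AddCircle.norm_coe_eq_abs_iff (2 * α) h2.ne').2 ?_
    rw [abs_of_pos h2, mul_div_cancel_left₀ _ two_ne_zero]
    exact abs_le.2 hx
  change f (projIcc 0 α hα.le ‖(x : AddCircle (2 * α))‖) = f (projIcc 0 α hα.le |x|)
  rw [this]

theorem integral_comp_coe (hα : 0 < α) [Fact (0 < 2 * α)] (Φ : C(AddCircle (2 * α), ℂ)) (m : ℤ) :
    ∫ x : ℝ, Φ x * Complex.exp (Complex.I * Real.pi * m * x / α) ∂intervalMeasure α =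
      ∫ x, Φ x * fourier m x ∂AddCircle.haarAddCircle := by
  have hα' : (α : ℂ) ≠ 0 := by exact_mod_cast hα.ne'
  rw [← measurePreserving_toCircle.map_eq, integral_map
    measurePreserving_toCircle.measurable.aemeasurable
    (Continuous.aestronglyMeasurable (by fun_prop))]
  congr 1
  funext x
  rw [fourier_coe_apply]
  congr 2
  push_cast
  field_simp

/-- Conjugation by `e^{iτD}` turns multiplication by a function on the circle into multiplication by
its translate. So `norm_le_of_exp_matrix` bounds the sup norm of `Φ (x + τ) - Φ x`, and for `τ = s -
t` its value at `x = t` is `f s - f t`. -/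
theorem lipschitz_of_commutator (hα : 0 < α) (f : C(Icc (0 : ℝ) α, ℂ))
    {B : IntervalL2 α →L[ℂ] IntervalL2 α} (hB : ∀ n k : ℤ,
      ⟪intervalBasis hα n, B (intervalBasis hα k)⟫_ℂ =
        (((Real.pi * n / α : ℝ) : ℂ) - ((Real.pi * k / α : ℝ) : ℂ)) *
          ⟪intervalBasis hα n, mulOp hα f (intervalBasis hα k)⟫_ℂ) (s t : Icc (0 : ℝ) α) :
    ‖f s - f t‖ ≤ |(s : ℝ) - t| * ‖B‖ := by
  have : Fact (0 < 2 * α) := ⟨by positivity⟩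
  have hα' : (α : ℂ) ≠ 0 := by exact_mod_cast hα.ne'
  set Φ := circleExtension hα f with hΦ
  set τ : ℝ := s - t with hτ
  let Ψ : C(AddCircle (2 * α), ℂ) :=
    ⟨fun x => Φ (x + (τ : AddCircle (2 * α))) - Φ x, by fun_prop⟩
  let g : ℝ → ℂ := fun x => Ψ (x : AddCircle (2 * α))
  have hc : Continuous g := Ψ.continuous.comp (AddCircle.continuous_mk' _)
  have hg : MemLp g ∞ (intervalMeasure α) := memLp_top_of_bound hc.aestronglyMeasurable ‖Ψ‖
    (Filter.Eventually.of_forall fun x => Ψ.norm_coe_le_norm _)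
  have hmat : ∀ n k : ℤ, ⟪intervalBasis hα n, mulOp hα f (intervalBasis hα k)⟫_ℂ =
      ∫ x, Φ x * fourier (k - n) x ∂AddCircle.haarAddCircle := by
    intro n k
    change ⟪intervalBasis hα n, mulLp (evenExtension hα f) (memLp_evenExtension hα f)
      (intervalBasis hα k)⟫_ℂ = _
    rw [inner_intervalBasis_mulLp, ← integral_comp_coe hα]
    refine integral_congr_ae ?_
    refine Measure.ae_smul_measure ?_ _
    filter_upwards [ae_restrict_mem measurableSet_Icc] with x hx
    rw [hΦ, circleExtension_coe hα f hx]
    push_cast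
    rfl
  have hA : ∀ n k : ℤ, ⟪intervalBasis hα n, mulLp g hg (intervalBasis hα k)⟫_ℂ =
      (Complex.exp (Complex.I * τ * (((Real.pi * n / α : ℝ) : ℂ) - ((Real.pi * k / α : ℝ) : ℂ))) - 1)
        * ⟪intervalBasis hα n, mulOp hα f (intervalBasis hα k)⟫_ℂ := by
    intro n k
    have h1 := integral_comp_coe hα Ψ (k - n)
    push_cast at h1
    rw [inner_intervalBasis_mulLp, hmat, h1]
    have hi : ∀ Θ : C(AddCircle (2 * α), ℂ), Integrable (fun x => Θ x)
        (AddCircle.haarAddCircle (T := 2 * α)) := fun Θ =>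
      Θ.continuous.integrable_of_hasCompactSupport (HasCompactSupport.of_compactSpace _)
    have h2 : ∫ x, Ψ x * fourier (k - n) x ∂AddCircle.haarAddCircle =
        (∫ x, Φ (x + (τ : AddCircle (2 * α))) * fourier (k - n) x ∂AddCircle.haarAddCircle) -
          ∫ x, Φ x * fourier (k - n) x ∂AddCircle.haarAddCircle := by
      have j1 : Integrable (fun x => Φ (x + (τ : AddCircle (2 * α))) * fourier (k - n) x)
          AddCircle.haarAddCircle :=
        hi ⟨fun x => Φ (x + (τ : AddCircle (2 * α))) * fourier (k - n) x, by fun_prop⟩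
      have j2 : Integrable (fun x => Φ x * fourier (k - n) x) AddCircle.haarAddCircle :=
        hi ⟨fun x => Φ x * fourier (k - n) x, by fun_prop⟩
      rw [← integral_sub j1 j2]
      congr 1
      funext x
      exact sub_mul _ _ _
    rw [h2, integral_circle_translate]
    have h3 : -(Complex.I * Real.pi * ((k - n : ℤ) : ℂ) * τ / α) =
        Complex.I * τ * (((Real.pi * n / α : ℝ) : ℂ) - ((Real.pi * k / α : ℝ) : ℂ)) := by
      push_cast
      field_simp
      ring
    rw [h3]
    ring
  have hn := norm_le_of_exp_matrix (intervalBasis hα) (fun k : ℤ => Real.pi * k / α) hB hA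
  have ht : (t : ℝ) ∈ Icc (-α) α := ⟨by linarith [t.2.1], t.2.2⟩
  have hs : (s : ℝ) ∈ Icc (-α) α := ⟨by linarith [s.2.1], s.2.2⟩
  have := norm_le_of_norm_mulLp_le hα hc hg (by positivity) hn ht
  have e : g t = f s - f t := by
    have e1 : ∀ r : Icc (0 : ℝ) α, evenExtension hα f (r : ℝ) = f r := fun r => by
      change f (projIcc 0 α hα.le |(r : ℝ)|) = _
      rw [abs_of_nonneg r.2.1, projIcc_val]
    change Φ ((t : ℝ) + (τ : AddCircle (2 * α))) - Φ (t : ℝ) = _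
    rw [← AddCircle.coe_add, hτ, add_sub_cancel, hΦ, circleExtension_coe hα f hs,
      circleExtension_coe hα f ht, e1, e1]
  rwa [e] at this

theorem eq_zero_of_mulOp_eq_zero (hα : 0 < α) {f : C(Icc (0 : ℝ) α, ℂ)} (h : mulOp hα f = 0)
    (t : Icc (0 : ℝ) α) : f t = 0 := by
  have h0 : ‖mulLp (evenExtension hα f) (memLp_evenExtension hα f)‖ ≤ 0 := by
    change ‖mulOp hα f‖ ≤ 0
    rw [h, norm_zero]
  have := norm_le_of_norm_mulLp_le hα (evenExtension hα f).continuous _ le_rfl h0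
    (t := t) ⟨by linarith [t.2.1], t.2.2⟩
  change ‖f (projIcc 0 α hα.le |(t : ℝ)|)‖ ≤ 0 at this
  rwa [abs_of_nonneg t.2.1, projIcc_val, norm_le_zero_iff] at this

end Interval

/-! ### Coordinates of tree points, and compactness -/

section Tree

universe v

variable {V : Type v} {G : SimpleGraph V} (hG : G.IsTree) (ℓ : G.edgeSet → ℝ) (p : ℝ≥0∞) (u : V)

theorem treePath_isPath (w : V) : (treePath hG u w).IsPath :=
  (hG.existsUnique_path u w).choose_spec.1

theorem eq_treePath {w : V} {P : G.Walk u w} (hP : P.IsPath) : P = treePath hG u w :=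
  (hG.existsUnique_path u w).choose_spec.2 P hP

theorem length_treePath (w : V) : (treePath hG u w).length = G.dist u w := by
  obtain ⟨P, hP, hl⟩ := hG.connected.exists_path_of_dist u w
  rw [← eq_treePath hG u hP, hl]

/-- If `b` lay on the path to `a`, cutting the path at `b` would make `b` strictly nearer to `u`
than `a`. -/
theorem treePath_eq_concat {a b : V} (hab : G.Adj a b) (hd : G.dist u a ≤ G.dist u b) :
    treePath hG u b = (treePath hG u a).concat hab := by
  classical
  refine (eq_treePath hG u ((treePath_isPath hG u a).concat (fun hb => ?_) hab)).symm
  have h1 := SimpleGraph.Walk.length_takeUntil_lt_length hb hab.ne'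
  have h2 := SimpleGraph.dist_le ((treePath hG u a).takeUntil b hb)
  rw [length_treePath] at h1
  omega

theorem nearEnd_mem (e : Sym2 V) : nearEnd G u e ∈ e := (exists_nearEnd G u e).choose_spec.1

theorem dist_nearEnd_le (e : Sym2 V) {v : V} (hv : v ∈ e) :
    G.dist u (nearEnd G u e) ≤ G.dist u v := (exists_nearEnd G u e).choose_spec.2 v hv

/-- The end of the edge `e` which is farthest from `u`. -/
noncomputable def farEnd (G : SimpleGraph V) (u : V) (e : Sym2 V) : V :=
  Sym2.Mem.other (nearEnd_mem (G := G) u e)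

theorem mk_nearEnd_farEnd (e : Sym2 V) : s(nearEnd G u e, farEnd G u e) = e :=
  Sym2.other_spec (nearEnd_mem u e)

theorem adj_nearEnd_farEnd (e : G.edgeSet) : G.Adj (nearEnd G u e) (farEnd G u e) := by
  rw [← SimpleGraph.mem_edgeSet, mk_nearEnd_farEnd]
  exact e.2

theorem treePath_farEnd (e : G.edgeSet) :
    treePath hG u (farEnd G u e) =
      (treePath hG u (nearEnd G u e)).concat (adj_nearEnd_farEnd u e) :=
  treePath_eq_concat hG u _ (dist_nearEnd_le u _ (Sym2.other_mem (nearEnd_mem u _)))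

open scoped Classical in
theorem sum_single_darts_apply (l : List G.Dart) (hl : (l.map SimpleGraph.Dart.edge).Nodup)
    (e : G.edgeSet) :
    ((l.map fun d => lp.single (E := fun _ : G.edgeSet => ℝ) p
      (⟨d.edge, d.edge_mem⟩ : G.edgeSet) (ℓ ⟨d.edge, d.edge_mem⟩)).sum :
        lp (fun _ : G.edgeSet => ℝ) p) e =
      if (e : Sym2 V) ∈ l.map SimpleGraph.Dart.edge then ℓ e else 0 := by
  induction l with
  | nil => simp
  | cons d l ih =>
    rw [List.map_cons, List.nodup_cons] at hl
    rw [List.map_cons, List.sum_cons, lp.coeFn_add, Pi.add_apply, ih hl.2, List.map_cons]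
    by_cases h : e = ⟨d.edge, d.edge_mem⟩
    · subst h
      rw [lp.single_apply_self, if_neg hl.1, if_pos (by simp), add_zero]
    · have h' : (e : Sym2 V) ≠ d.edge := fun h' => h (Subtype.ext h')
      rw [lp.single_apply_ne _ _ _ h, zero_add]
      simp [h']

open scoped Classical in
theorem vertexPoint_apply (w : V) (e : G.edgeSet) :
    vertexPoint hG ℓ p u w e = if (e : Sym2 V) ∈ (treePath hG u w).edges then ℓ e else 0 :=
  sum_single_darts_apply ℓ p _ (treePath_isPath hG u w).isTrail.edges_nodup e

/-- The path to the far end finishes with `e` and repeats no edge, so `e` is not on its initial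
part. -/
theorem vertexPoint_nearEnd_apply_self (e : G.edgeSet) :
    vertexPoint hG ℓ p u (nearEnd G u e) e = 0 := by
  classical
  rw [vertexPoint_apply, if_neg]
  have h := (treePath_isPath hG u (farEnd G u e)).isTrail.edges_nodup
  rw [treePath_farEnd, SimpleGraph.Walk.edges_concat, List.concat_eq_append,
    List.nodup_append] at h
  intro he
  exact h.2.2 _ he _ (List.mem_singleton_self _) (mk_nearEnd_farEnd u _).symm

open scoped Classical in
theorem vertexPoint_farEnd (e : G.edgeSet) :
    vertexPoint hG ℓ p u (farEnd G u e) =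
      vertexPoint hG ℓ p u (nearEnd G u e) + lp.single p e (ℓ e) := by
  refine lp.ext (funext fun e' => ?_)
  rw [lp.coeFn_add, Pi.add_apply, vertexPoint_apply, treePath_farEnd,
    SimpleGraph.Walk.edges_concat, List.concat_eq_append]
  by_cases h : e' = e
  · subst h
    rw [vertexPoint_nearEnd_apply_self, lp.single_apply_self, if_pos, zero_add]
    rw [mk_nearEnd_farEnd]
    simp
  · rw [lp.single_apply_ne _ _ _ h, add_zero, vertexPoint_apply]
    have h' : (e' : Sym2 V) ≠ e := fun h' => h (Subtype.ext h')
    rw [mk_nearEnd_farEnd]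
    simp [h']

open scoped Classical in
theorem edgePoint_apply (e e' : G.edgeSet) (t : ℝ) :
    edgePoint hG ℓ p u e t e' =
      if e' = e then t else vertexPoint hG ℓ p u (nearEnd G u e) e' := by
  rw [edgePoint, lp.coeFn_add, Pi.add_apply, lp.coeFn_smul, Pi.smul_apply]
  split_ifs with h
  · subst h
    rw [vertexPoint_nearEnd_apply_self, lp.single_apply_self, zero_add, smul_eq_mul, mul_one]
  · rw [lp.single_apply_ne _ _ _ h, smul_zero, add_zero]

theorem edgePoint_zero (e : G.edgeSet) :
    edgePoint hG ℓ p u e 0 = vertexPoint hG ℓ p u (nearEnd G u e) := by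
  rw [edgePoint, zero_smul, add_zero]

theorem edgePoint_length (e : G.edgeSet) :
    edgePoint hG ℓ p u e (ℓ e) = vertexPoint hG ℓ p u (farEnd G u e) := by
  classical
  rw [edgePoint, vertexPoint_farEnd, ← lp.single_smul, smul_eq_mul, mul_one]

variable {ℓ} (hℓ : ∀ e, 0 < ℓ e)

include hℓ in
theorem exists_edgePoint_eq_vertexPoint (e : G.edgeSet) {a : V} (ha : a ∈ (e : Sym2 V)) :
    ∃ t ∈ Icc 0 (ℓ e), edgePoint hG ℓ p u e t = vertexPoint hG ℓ p u a := by
  rw [← mk_nearEnd_farEnd (G := G) u (e : Sym2 V), Sym2.mem_iff] at ha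
  rcases ha with rfl | rfl
  · exact ⟨0, ⟨le_rfl, (hℓ e).le⟩, edgePoint_zero hG ℓ p u e⟩
  · exact ⟨ℓ e, ⟨(hℓ e).le, le_rfl⟩, edgePoint_length hG ℓ p u e⟩

include hℓ in
theorem vertexPoint_mem_treePoints [Nontrivial V] (w : V) :
    vertexPoint hG ℓ p u w ∈ treePoints hG ℓ p u := by
  obtain ⟨v, hv⟩ := hG.connected.preconnected.exists_adj_of_nontrivial w
  obtain ⟨t, ht, h⟩ := exists_edgePoint_eq_vertexPoint hG p u hℓ ⟨s(w, v), hv⟩ (Sym2.mem_mk_left w v)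
  exact ⟨_, t, ht, h⟩

include hℓ in
theorem vertexPoint_apply_mem_Icc (w : V) (e : G.edgeSet) :
    vertexPoint hG ℓ p u w e ∈ Icc 0 (ℓ e) := by
  classical
  rw [vertexPoint_apply]
  split_ifs
  · exact ⟨(hℓ e).le, le_rfl⟩
  · exact ⟨le_rfl, (hℓ e).le⟩

include hℓ in
theorem apply_mem_Icc_of_mem_treePoints {x : lp (fun _ : G.edgeSet => ℝ) p}
    (hx : x ∈ treePoints hG ℓ p u) (e : G.edgeSet) : x e ∈ Icc 0 (ℓ e) := by
  classical
  obtain ⟨e', t, ht, rfl⟩ := hx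
  rw [edgePoint_apply]
  split_ifs with h
  · subst h
    exact ht
  · exact vertexPoint_apply_mem_Icc hG p u hℓ _ e

section Compact

variable {ι : Type*} {p} [Fact (1 ≤ p)]

/-- The box is the image of a product of compact intervals. The map into `ℓ^p` is continuous as a
uniform limit of finite partial sums: all tails are dominated by that of `m`, which vanishes since
`p` is finite. -/
theorem isCompact_box (hp : p ≠ ∞) (m : lp (fun _ : ι => ℝ) p) (hm : ∀ i, 0 ≤ m i) :
    IsCompact {x : lp (fun _ : ι => ℝ) p | ∀ i, x i ∈ Icc 0 (m i)} := by
  classical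
  have hp0 : p ≠ 0 := (zero_lt_one.trans_le Fact.out).ne'
  have hle : ∀ (x : ∀ i, Icc 0 (m i)) (i : ι), ‖(x i : ℝ)‖ ≤ ‖m i‖ := fun x i => by
    rw [Real.norm_of_nonneg (x i).2.1, Real.norm_of_nonneg (hm i)]
    exact (x i).2.2
  let Φ : (∀ i, Icc 0 (m i)) → lp (fun _ : ι => ℝ) p := fun x =>
    ⟨fun i => (x i : ℝ), (lp.memℓp m).mono' (hle x)⟩
  have happ : ∀ (f : ι → ℝ) (s : Finset ι) (i : ι),
      ((∑ j ∈ s, lp.single p j (f j) : lp (fun _ : ι => ℝ) p) i) = if i ∈ s then f i else 0 := by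
    intro f s i
    rw [lp.coeFn_sum, Finset.sum_apply]
    simp only [lp.single_apply]
    simp [Pi.single_apply]
  have hΦ : Continuous Φ := by
    have hunif : TendstoUniformly (fun (s : Finset ι) (x : ∀ i, Icc 0 (m i)) =>
        (∑ j ∈ s, lp.single p j (x j : ℝ) : lp (fun _ : ι => ℝ) p)) Φ Filter.atTop := by
      rw [Metric.tendstoUniformly_iff]
      intro ε hε
      have h := lp.hasSum_single hp m
      rw [HasSum, SummationFilter.unconditional_filter, Metric.tendsto_nhds] at h
      filter_upwards [h ε hε] with s hs x
      refine lt_of_le_of_lt ?_ hs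
      rw [dist_eq_norm, dist_comm, dist_eq_norm]
      refine lp.norm_mono hp0 fun i => ?_
      rw [lp.coeFn_sub, Pi.sub_apply, lp.coeFn_sub, Pi.sub_apply, happ, happ]
      split_ifs
      · simp [Φ]
      · simpa using hle x i
    refine hunif.continuous (Filter.Eventually.frequently (Filter.Eventually.of_forall fun s => ?_))
    refine continuous_finsetSum _ fun j _ => ?_
    exact (lp.isometry_single j).continuous.comp
      (continuous_subtype_val.comp (continuous_apply j))
  have hrange : {x : lp (fun _ : ι => ℝ) p | ∀ i, x i ∈ Icc 0 (m i)} = range Φ := by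
    ext x
    constructor
    · intro hx
      exact ⟨fun i => ⟨x i, hx i⟩, lp.ext rfl⟩
    · rintro ⟨y, rfl⟩ i
      exact (y i).2
  rw [hrange]
  exact isCompact_range hΦ

end Compact

variable [Fact (1 ≤ p)]

include hℓ in
theorem compactSpace_treeSpace (hp : p ≠ ∞) (hsum : Summable fun e => ℓ e ^ p.toReal) :
    CompactSpace (TreeSpace hG ℓ p u) := by
  have hp0 : 0 < p.toReal :=
    ENNReal.toReal_pos (zero_lt_one.trans_le Fact.out).ne' hp
  have hmem : Memℓp ℓ p := by
    rw [memℓp_gen_iff hp0]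
    simpa only [Real.norm_of_nonneg (hℓ _).le] using hsum
  rw [← isCompact_iff_compactSpace]
  have hK := isCompact_box hp (⟨ℓ, hmem⟩ : lp (fun _ : G.edgeSet => ℝ) p) fun e => (hℓ e).le
  refine hK.of_isClosed_subset isClosed_closure (closure_minimal ?_ hK.isClosed)
  exact fun x hx e => apply_mem_Icc_of_mem_treePoints hG p u hℓ hx e

end Tree

/-! ### Curves whose length is the `ℓ¹`-distance -/

section Geodesic

theorem IsCurve.trans {E X : Type*} {ℓ : E → ℝ} {r : ∀ e, Icc (0 : ℝ) (ℓ e) → X} {x y z : X}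
    {L L' : ℝ} (h : IsCurve r x y L) (h' : IsCurve r y z L') : IsCurve r x z (L + L') := by
  induction h with
  | nil x => simpa using h'
  | cons e s t y L h ih =>
    rw [add_assoc]
    exact IsCurve.cons e s t z _ (ih h')

theorem IsCurve.single {E X : Type*} {ℓ : E → ℝ} {r : ∀ e, Icc (0 : ℝ) (ℓ e) → X} (e : E)
    (s t : Icc (0 : ℝ) (ℓ e)) : IsCurve r (r e s) (r e t) |(s : ℝ) - t| := by
  simpa using IsCurve.cons e s t (r e t) 0 (IsCurve.nil _)

universe v

variable {V : Type v} {G : SimpleGraph V} (hG : G.IsTree) {ℓ : G.edgeSet → ℝ} (p : ℝ≥0∞) (u : V)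
  [Fact (1 ≤ p)]

/-- There is a curve from `x` to `y` whose length is the `ℓ¹`-distance. -/
def JoinedByGeodesic (x y : TreeSpace hG ℓ p u) : Prop :=
  ∃ L, IsCurve (fun e => edgeCurve hG ℓ p u e) x y L ∧ HasSum (fun e => |x.1 e - y.1 e|) L

/-- By `hb` no coordinate changes on both pieces, so the `ℓ¹`-distances add without loss. -/
theorem JoinedByGeodesic.trans {x y z : TreeSpace hG ℓ p u} (h : JoinedByGeodesic hG p u x y)
    (h' : JoinedByGeodesic hG p u y z) (hb : ∀ e, x.1 e = y.1 e ∨ y.1 e = z.1 e) :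
    JoinedByGeodesic hG p u x z := by
  obtain ⟨L, hc, hs⟩ := h
  obtain ⟨L', hc', hs'⟩ := h'
  refine ⟨L + L', hc.trans hc', ?_⟩
  convert hs.add hs' using 2 with e
  rcases hb e with h | h <;> simp [h]

theorem JoinedByGeodesic.edge (e : G.edgeSet) (s t : Icc (0 : ℝ) (ℓ e)) :
    JoinedByGeodesic hG p u (edgeCurve hG ℓ p u e s) (edgeCurve hG ℓ p u e t) := by
  classical
  refine ⟨_, IsCurve.single e s t, ?_⟩
  have h := hasSum_single (f := fun e' => |edgePoint hG ℓ p u e s e' - edgePoint hG ℓ p u e t e'|) e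
    fun e' he' => by
      rw [edgePoint_apply, edgePoint_apply, if_neg he', if_neg he', sub_self, abs_zero]
  have h' : |edgePoint hG ℓ p u e s e - edgePoint hG ℓ p u e t e| = |(s : ℝ) - t| := by
    rw [edgePoint_apply, edgePoint_apply, if_pos rfl, if_pos rfl]
  rw [h'] at h
  exact h

variable (hℓ : ∀ e, 0 < ℓ e)

/-- The vertex `w` as a point of the space of the `p`-parameterization. -/
noncomputable def treeVertex [Nontrivial V] (w : V) : TreeSpace hG ℓ p u :=
  ⟨vertexPoint hG ℓ p u w, subset_closure (vertexPoint_mem_treePoints hG p u hℓ w)⟩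

variable [Nontrivial V]

theorem exists_edgeCurve_eq_treeVertex (e : G.edgeSet) {a : V} (ha : a ∈ (e : Sym2 V)) :
    ∃ t, edgeCurve hG ℓ p u e t = treeVertex hG p u hℓ a := by
  obtain ⟨t, ht, h⟩ := exists_edgePoint_eq_vertexPoint hG p u hℓ e ha
  exact ⟨⟨t, ht⟩, Subtype.ext h⟩

theorem vertexPoint_apply_eq_of_mem {e e' : G.edgeSet} (hne : e' ≠ e) {a b : V}
    (ha : a ∈ (e : Sym2 V)) (hb : b ∈ (e : Sym2 V)) :
    vertexPoint hG ℓ p u a e' = vertexPoint hG ℓ p u b e' := by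
  classical
  have key : ∀ c ∈ (e : Sym2 V), vertexPoint hG ℓ p u c e' =
      vertexPoint hG ℓ p u (nearEnd G u e) e' := by
    intro c hc
    rw [← mk_nearEnd_farEnd (G := G) u (e : Sym2 V), Sym2.mem_iff] at hc
    rcases hc with rfl | rfl
    · rfl
    · rw [vertexPoint_farEnd, lp.coeFn_add, Pi.add_apply, lp.single_apply_ne _ _ _ hne, add_zero]
  rw [key a ha, key b hb]

/-- Each step changes only the coordinate of its edge, and a trail crosses an edge at most once. The
second conjunct carries this through the induction: it says that the rest of the trail leaves the
first edge's coordinate alone. -/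
theorem joinedByGeodesic_of_isTrail {a b : V} (W : G.Walk a b) (hW : W.edges.Nodup) :
    JoinedByGeodesic hG p u (treeVertex hG p u hℓ a) (treeVertex hG p u hℓ b) ∧
      ∀ e : G.edgeSet, (e : Sym2 V) ∉ W.edges →
        vertexPoint hG ℓ p u a e = vertexPoint hG ℓ p u b e := by
  induction W with
  | nil =>
    refine ⟨⟨0, IsCurve.nil _, ?_⟩, fun _ _ => rfl⟩
    simp
  | @cons a c b hac W ih =>
    rw [SimpleGraph.Walk.edges_cons, List.nodup_cons] at hW
    obtain ⟨h1, h2⟩ := ih hW.2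
    let e0 : G.edgeSet := ⟨s(a, c), hac⟩
    obtain ⟨s, hs⟩ := exists_edgeCurve_eq_treeVertex hG p u hℓ e0 (Sym2.mem_mk_left a c)
    obtain ⟨t, ht⟩ := exists_edgeCurve_eq_treeVertex hG p u hℓ e0 (Sym2.mem_mk_right a c)
    have hedge := JoinedByGeodesic.edge hG p u e0 s t
    rw [hs, ht] at hedge
    have hoff : ∀ e, e ≠ e0 → vertexPoint hG ℓ p u a e = vertexPoint hG ℓ p u c e := fun e he =>
      vertexPoint_apply_eq_of_mem hG p u he (Sym2.mem_mk_left a c) (Sym2.mem_mk_right a c)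
    refine ⟨hedge.trans hG p u h1 fun e => ?_, fun e he => ?_⟩
    · by_cases h : e = e0
      · exact Or.inr (h2 e (by rw [h]; exact hW.1))
      · exact Or.inl (hoff e h)
    · rw [SimpleGraph.Walk.edges_cons, List.mem_cons, not_or] at he
      rw [hoff e fun h => he.1 (congrArg Subtype.val h), h2 e he.2]

theorem joinedByGeodesic_treeVertex (a b : V) :
    JoinedByGeodesic hG p u (treeVertex hG p u hℓ a) (treeVertex hG p u hℓ b) :=
  (joinedByGeodesic_of_isTrail hG p u hℓ (treePath hG a b)
    (treePath_isPath hG a b).isTrail.edges_nodup).1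

/-- One end of the edge `e` has the same `e`-coordinate as a given vertex. -/
theorem exists_end_apply_eq (e : G.edgeSet) (b : V) :
    ∃ a ∈ (e : Sym2 V), vertexPoint hG ℓ p u a e = vertexPoint hG ℓ p u b e := by
  classical
  rw [vertexPoint_apply hG ℓ p u b e]
  split_ifs
  · refine ⟨farEnd G u e, Sym2.other_mem _, ?_⟩
    rw [← edgePoint_length, edgePoint_apply, if_pos rfl]
  · exact ⟨nearEnd G u e, nearEnd_mem u _, vertexPoint_nearEnd_apply_self hG ℓ p u e⟩

include hℓ in
theorem joinedByGeodesic_of_mem_treePoints {x y : TreeSpace hG ℓ p u}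
    (hx : (x : lp (fun _ : G.edgeSet => ℝ) p) ∈ treePoints hG ℓ p u)
    (hy : (y : lp (fun _ : G.edgeSet => ℝ) p) ∈ treePoints hG ℓ p u) :
    JoinedByGeodesic hG p u x y := by
  classical
  obtain ⟨e, s, hs, hxs⟩ := hx
  obtain ⟨e', t, ht, hyt⟩ := hy
  have hx' : x = edgeCurve hG ℓ p u e ⟨s, hs⟩ := Subtype.ext hxs.symm
  have hy' : y = edgeCurve hG ℓ p u e' ⟨t, ht⟩ := Subtype.ext hyt.symm
  by_cases hee : e = e'
  · subst hee
    rw [hx', hy']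
    exact JoinedByGeodesic.edge hG p u e _ _
  -- The curve leaves `e` by the end `a` whose `e`-coordinate is the one shared by all points of
  -- `e'`, and enters `e'` by the end `b` chosen symmetrically. Then the pieces from `x` to `a`,
  -- from `a` to `b` and from `b` to `y` change disjoint sets of coordinates.
  · obtain ⟨a, ha, hae⟩ := exists_end_apply_eq hG p u (ℓ := ℓ) e (nearEnd G u e')
    obtain ⟨b, hb, hbe⟩ := exists_end_apply_eq hG p u (ℓ := ℓ) e' (nearEnd G u e)
    obtain ⟨s', hs'⟩ := exists_edgeCurve_eq_treeVertex hG p u hℓ e ha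
    obtain ⟨t', ht'⟩ := exists_edgeCurve_eq_treeVertex hG p u hℓ e' hb
    have h1 := JoinedByGeodesic.edge hG p u e ⟨s, hs⟩ s'
    have h3 := JoinedByGeodesic.edge hG p u e' t' ⟨t, ht⟩
    rw [hs', ← hx'] at h1
    rw [ht', ← hy'] at h3
    have hxa : ∀ f, f ≠ e → x.1 f = vertexPoint hG ℓ p u a f := fun f hf => by
      rw [← hxs, edgePoint_apply, if_neg hf]
      exact vertexPoint_apply_eq_of_mem hG p u hf (nearEnd_mem u _) ha
    have hby : ∀ f, f ≠ e' → vertexPoint hG ℓ p u b f = y.1 f := fun f hf => by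
      rw [← hyt, edgePoint_apply, if_neg hf]
      exact vertexPoint_apply_eq_of_mem hG p u hf hb (nearEnd_mem u _)
    have hab : vertexPoint hG ℓ p u a e = vertexPoint hG ℓ p u b e := by
      rw [hae]
      exact vertexPoint_apply_eq_of_mem hG p u hee (nearEnd_mem u _) hb
    have hxb : x.1 e' = vertexPoint hG ℓ p u b e' := by
      rw [hxa e' (Ne.symm hee), hbe]
      exact vertexPoint_apply_eq_of_mem hG p u (Ne.symm hee) ha (nearEnd_mem u _)
    have h2 := h1.trans hG p u (joinedByGeodesic_treeVertex hG p u hℓ a b) fun f => by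
      by_cases hf : f = e
      · exact Or.inr (by rw [hf]; exact hab)
      · exact Or.inl (hxa f hf)
    refine h2.trans hG p u h3 fun f => ?_
    by_cases hf : f = e'
    · exact Or.inl (by rw [hf]; exact hxb)
    · exact Or.inr (hby f hf)

end Geodesic

/-! ### Summability of the eigenvalues -/

section Eigenvalues

variable {E : Type*} {ℓ : E → ℝ}

/-- The eigenvalue is `(π / 2) (2 k + 1) / ℓ e` and `π / 2 ≥ 1`, so the terms are dominated by the
product of the series `ℓ e ^ s` and `|2 k + 1| ^ (-s)`. The half-step shift makes this bound valid
at `k = 0` too. -/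
theorem summable_eigenvalues (hℓ : ∀ e, 0 < ℓ e) {s : ℝ} (hs : 1 < s)
    (hsum : Summable fun e => ℓ e ^ s) : Summable fun q : E × ℤ =>
      (1 + (Real.pi * q.2 / ℓ q.1 + Real.pi / (2 * ℓ q.1)) ^ 2) ^ (-(s / 2)) := by
  have hk : Summable fun k : ℤ => |((2 * k + 1 : ℤ) : ℝ)| ^ (-s) :=
    (Real.summable_abs_int_rpow hs).comp_injective (i := fun k : ℤ => 2 * k + 1)
      fun a b h => by simpa using h
  have hprod := hsum.mul_of_nonneg hk (fun e => Real.rpow_nonneg (hℓ e).le _)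
    fun k => Real.rpow_nonneg (abs_nonneg _) _
  refine Summable.of_nonneg_of_le (fun q => by positivity) (fun q => ?_) hprod
  obtain ⟨e, k⟩ := q
  have hl := hℓ e
  have hodd : (0 : ℝ) < |((2 * k + 1 : ℤ) : ℝ)| := by
    rw [abs_pos]
    exact_mod_cast (by omega : (2 * k + 1 : ℤ) ≠ 0)
  have hle : (|((2 * k + 1 : ℤ) : ℝ)| / ℓ e) ^ 2 ≤
      1 + (Real.pi * k / ℓ e + Real.pi / (2 * ℓ e)) ^ 2 := by
    have e1 : (Real.pi * k / ℓ e + Real.pi / (2 * ℓ e)) ^ 2 =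
        (Real.pi / 2) ^ 2 * (|((2 * k + 1 : ℤ) : ℝ)| / ℓ e) ^ 2 := by
      rw [div_pow |((2 * k + 1 : ℤ) : ℝ)|, sq_abs]
      push_cast
      field_simp
    have h2 : 1 ≤ (Real.pi / 2) ^ 2 := by nlinarith [Real.pi_gt_three]
    rw [e1]
    nlinarith [sq_nonneg (|((2 * k + 1 : ℤ) : ℝ)| / ℓ e)]
  calc _ ≤ ((|((2 * k + 1 : ℤ) : ℝ)| / ℓ e) ^ 2) ^ (-(s / 2)) :=
        Real.rpow_le_rpow_of_nonpos (by positivity) hle (by linarith)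
    _ = ℓ e ^ s * |((2 * k + 1 : ℤ) : ℝ)| ^ (-s) := by
        rw [← Real.rpow_natCast, ← Real.rpow_mul (by positivity),
          show ((2 : ℕ) : ℝ) * -(s / 2) = -s by push_cast; ring,
          Real.div_rpow hodd.le hl.le, Real.rpow_neg hl.le, div_inv_eq_mul, mul_comm]

theorem one_lt_of_summable_eigenvalues {l s : ℝ} (hl : 0 < l) (hs : 0 < s)
    (h : Summable fun k : ℤ => (1 + (Real.pi * k / l + Real.pi / (2 * l)) ^ 2) ^ (-(s / 2))) :
    1 < s := by
  have hn : Summable fun n : ℕ =>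
      (1 + (Real.pi * ((n : ℤ) : ℝ) / l + Real.pi / (2 * l)) ^ 2) ^ (-(s / 2)) :=
    h.comp_injective Nat.cast_injective
  -- For `n ≥ 1`, `2 n + 1 ≤ 3 n` and `1 ≤ n ^ 2`, so one plus the squared eigenvalue is at most `K
  -- n ^ 2`.
  set K : ℝ := 1 + (3 * Real.pi / (2 * l)) ^ 2 with hK
  have hK0 : 0 < K := by positivity
  have hle : ∀ n : ℕ, K ^ (-(s / 2)) * (n : ℝ) ^ (-s) ≤
      (1 + (Real.pi * ((n : ℤ) : ℝ) / l + Real.pi / (2 * l)) ^ 2) ^ (-(s / 2)) := by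
    intro n
    rcases Nat.eq_zero_or_pos n with rfl | hn
    -- Here `0 ^ (-s)` is `0` by convention, so the bound also holds at `n = 0`.
    · rw [Nat.cast_zero, Real.zero_rpow (by linarith), mul_zero]
      positivity
    · have h1 : (1 : ℝ) ≤ n := by exact_mod_cast hn
      have e1 : (n : ℝ) ^ (-s) = ((n : ℝ) ^ 2) ^ (-(s / 2)) := by
        rw [← Real.rpow_natCast, ← Real.rpow_mul (by positivity)]
        congr 1
        push_cast
        ring
      rw [e1, ← Real.mul_rpow hK0.le (by positivity)]
      refine Real.rpow_le_rpow_of_nonpos (by positivity) ?_ (by linarith)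
      have h2 : Real.pi * ((n : ℤ) : ℝ) / l + Real.pi / (2 * l) ≤ 3 * Real.pi / (2 * l) * n := by
        have h3 : 0 ≤ Real.pi / (2 * l) := by positivity
        have e2 : Real.pi * ((n : ℤ) : ℝ) / l + Real.pi / (2 * l) =
            Real.pi / (2 * l) * (2 * n + 1) := by
          push_cast
          field_simp
        rw [e2, show 3 * Real.pi / (2 * l) * n = Real.pi / (2 * l) * (3 * n) by ring]
        exact mul_le_mul_of_nonneg_left (by linarith) h3
      have h4 : (Real.pi * ((n : ℤ) : ℝ) / l + Real.pi / (2 * l)) ^ 2 ≤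
          (3 * Real.pi / (2 * l) * n) ^ 2 := pow_le_pow_left₀ (by positivity) h2 2
      rw [hK, add_mul, one_mul, ← mul_pow]
      nlinarith
  have hsum := Summable.of_nonneg_of_le (fun n : ℕ => by positivity) hle hn
  rw [summable_mul_left_iff (by positivity), Real.summable_nat_rpow] at hsum
  linarith

/-- With `k = 0`, one plus the squared eigenvalue is `(ℓ e ^ 2 + (π / 2) ^ 2) / ℓ e ^ 2`, at most a
constant over `ℓ e ^ 2` because the lengths are bounded. -/
theorem summable_of_summable_eigenvalues (hℓ : ∀ e, 0 < ℓ e) {M s : ℝ} (hM : ∀ e, ℓ e ≤ M)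
    (hs : 0 < s) (h : Summable fun e =>
      (1 + (Real.pi * (0 : ℤ) / ℓ e + Real.pi / (2 * ℓ e)) ^ 2) ^ (-(s / 2))) :
    Summable fun e => ℓ e ^ s := by
  set K : ℝ := M ^ 2 + (Real.pi / 2) ^ 2 with hK
  have hK0 : 0 < K := by positivity
  rw [← summable_mul_left_iff (a := K ^ (-(s / 2))) (by positivity)]
  refine Summable.of_nonneg_of_le (fun e => ?_) (fun e => ?_) h
  · have := hℓ e
    positivity
  · have hl := hℓ e
    have e1 : ℓ e ^ s = ((ℓ e ^ 2)⁻¹) ^ (-(s / 2)) := by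
      rw [Real.inv_rpow (by positivity), ← Real.rpow_neg (by positivity), neg_neg,
        ← Real.rpow_natCast, ← Real.rpow_mul hl.le]
      congr 1
      push_cast
      ring
    rw [e1, ← Real.mul_rpow hK0.le (by positivity)]
    refine Real.rpow_le_rpow_of_nonpos (by positivity) ?_ (by linarith)
    rw [hK, ← div_eq_mul_inv, le_div_iff₀ (by positivity)]
    have e2 : (1 + (Real.pi * (0 : ℤ) / ℓ e + Real.pi / (2 * ℓ e)) ^ 2) * ℓ e ^ 2 =
        ℓ e ^ 2 + (Real.pi / 2) ^ 2 := by
      push_cast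
      field_simp
      ring
    rw [e2]
    have := pow_le_pow_left₀ hl.le (hM e) 2
    linarith

theorem exists_forall_le_of_summable_rpow (hℓ : ∀ e, 0 < ℓ e) {r : ℝ} (hr : 0 < r)
    (hsum : Summable fun e => ℓ e ^ r) : ∃ M, 0 ≤ M ∧ ∀ e, ℓ e ≤ M := by
  have hnn : ∀ e, 0 ≤ ℓ e ^ r := fun e => Real.rpow_nonneg (hℓ e).le _
  refine ⟨(∑' e, ℓ e ^ r) ^ r⁻¹, Real.rpow_nonneg (tsum_nonneg hnn) _, fun e => ?_⟩
  rw [Real.le_rpow_inv_iff_of_pos (hℓ e).le (tsum_nonneg hnn) hr]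
  exact hsum.le_tsum e fun j _ => hnn j

/-- The exponent `r` may be at most `1`, so summability is used at `r + 1`, where it persists since
the lengths are bounded. Its terms tend to zero, and the power `2 / (r + 1)` turns them into the
resolvent's eigenvalues. -/
theorem tendsto_inv_one_add_sq (hℓ : ∀ e, 0 < ℓ e) {r : ℝ} (hr : 0 < r)
    (hsum : Summable fun e => ℓ e ^ r) : Filter.Tendsto (fun q : E × ℤ =>
      (((1 + (Real.pi * q.2 / ℓ q.1 + Real.pi / (2 * ℓ q.1)) ^ 2)⁻¹ : ℝ) : ℂ))
      Filter.cofinite (nhds 0) := by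
  obtain ⟨M, hM0, hM⟩ := exists_forall_le_of_summable_rpow hℓ hr hsum
  have h1 : Summable fun e => ℓ e ^ (r + 1) := by
    refine Summable.of_nonneg_of_le (fun e => Real.rpow_nonneg (hℓ e).le _) (fun e => ?_)
      (hsum.mul_right M)
    rw [Real.rpow_add_one (hℓ e).ne']
    exact mul_le_mul_of_nonneg_left (hM e) (Real.rpow_nonneg (hℓ e).le _)
  have h2 := (summable_eigenvalues hℓ (by linarith) h1).tendsto_cofinite_zero
  have hpos : 0 < 2 / (r + 1) := by positivity
  have h3 := h2.rpow_const (Or.inr hpos.le)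
  rw [Real.zero_rpow hpos.ne'] at h3
  have h4 := (Complex.continuous_ofReal.tendsto 0).comp h3
  rw [Complex.ofReal_zero] at h4
  refine h4.congr fun q => ?_
  rw [Function.comp_apply, ← Real.rpow_mul (by positivity), ← Real.rpow_neg_one]
  congr 2
  field_simp

end Eigenvalues

/-! ### The algebra of bounded commutators -/

section Commutator

variable {H : Type*} [NormedAddCommGroup H] [InnerProductSpace ℂ H] [CompleteSpace H]
  {D : H →ₗ.[ℂ] H} {S T B C : H →L[ℂ] H}

theorem IsCommutator.add (hS : IsCommutator D S B) (hT : IsCommutator D T C) :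
    IsCommutator D (S + T) (B + C) := by
  obtain ⟨h1, h2⟩ := hS
  obtain ⟨h3, h4⟩ := hT
  refine ⟨fun ξ => D.domain.add_mem (h1 ξ) (h3 ξ), fun ξ => ?_⟩
  have e : D ⟨(S + T) ξ, D.domain.add_mem (h1 ξ) (h3 ξ)⟩ = D ⟨S ξ, h1 ξ⟩ + D ⟨T ξ, h3 ξ⟩ :=
    D.map_add ⟨S ξ, h1 ξ⟩ ⟨T ξ, h3 ξ⟩
  rw [e, add_apply, add_apply, ← h2, ← h4]
  abel

theorem IsCommutator.mul (hS : IsCommutator D S B) (hT : IsCommutator D T C) :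
    IsCommutator D (S * T) (B * T + S * C) := by
  obtain ⟨h1, h2⟩ := hS
  obtain ⟨h3, h4⟩ := hT
  refine ⟨fun ξ => h1 ⟨T ξ, h3 ξ⟩, fun ξ => ?_⟩
  have e1 := h2 ⟨T ξ, h3 ξ⟩
  have e2 := congrArg S (h4 ξ)
  rw [map_sub] at e2
  change D ⟨S (T ξ), _⟩ - S (T (D ξ)) = B (T ξ) + S (C ξ)
  rw [← e1, ← e2]
  abel

theorem isCommutator_algebraMap (a : ℂ) :
    IsCommutator D (algebraMap ℂ (H →L[ℂ] H) a) 0 := by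
  have e : ∀ ξ : H, algebraMap ℂ (H →L[ℂ] H) a ξ = a • ξ := fun ξ => by
    simp [Algebra.algebraMap_eq_smul_one]
  refine ⟨fun ξ => by rw [e]; exact D.domain.smul_mem a ξ.2, fun ξ => ?_⟩
  have h : ∀ h, D ⟨algebraMap ℂ (H →L[ℂ] H) a ξ, h⟩ = a • D ξ := fun h => by
    rw [← D.map_smul]
    congr 1
  rw [h, e, sub_self, zero_apply]

/-- Stone–Weierstrass, with the Leibniz rule for products. As `s` consists of self-adjoint
functions, the star subalgebra it generates is the plain subalgebra, and commutators of adjoints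
need not be examined. -/
theorem dense_boundedCommutator_of_separatesPoints {X : Type*} [TopologicalSpace X]
    [CompactSpace X] (M : Triple C(X, ℂ) H) (s : Set C(X, ℂ)) (hstar : ∀ f ∈ s, star f = f)
    (hs : ∀ f ∈ s, ∃ B, IsCommutator M.dirac (M.rep f) B)
    (hsep : ∀ x y : X, x ≠ y → ∃ f ∈ s, f x ≠ f y) :
    Dense {f : C(X, ℂ) | ∃ B, IsCommutator M.dirac (M.rep f) B} := by
  have hss : star s = s := by
    ext f
    rw [Set.mem_star]
    refine ⟨fun h => ?_, fun h => by rwa [hstar f h]⟩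
    have := hstar _ h
    rw [star_star] at this
    rwa [this]
  have hsub : ((StarAlgebra.adjoin ℂ s : StarSubalgebra ℂ C(X, ℂ)) : Set C(X, ℂ)) ⊆
      {f : C(X, ℂ) | ∃ B, IsCommutator M.dirac (M.rep f) B} := by
    intro f hf
    have hf' : f ∈ Algebra.adjoin ℂ s := by
      have : f ∈ (StarAlgebra.adjoin ℂ s).toSubalgebra := hf
      rwa [StarAlgebra.adjoin_toSubalgebra, hss, union_self] at this
    clear hf
    change ∃ B, IsCommutator M.dirac (M.rep f) B
    induction hf' using Algebra.adjoin_induction with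
    | mem f hf => exact hs f hf
    | algebraMap r =>
      refine ⟨0, ?_⟩
      rw [AlgHomClass.commutes]
      exact isCommutator_algebraMap r
    | add f g _ _ hf hg =>
      obtain ⟨B, hB⟩ := hf
      obtain ⟨C, hC⟩ := hg
      rw [map_add]
      exact ⟨_, hB.add hC⟩
    | mul f g _ _ hf hg =>
      obtain ⟨B, hB⟩ := hf
      obtain ⟨C, hC⟩ := hg
      rw [map_mul]
      exact ⟨_, hB.mul hC⟩
  refine Dense.mono hsub ?_
  have htop := ContinuousMap.starSubalgebra_topologicalClosure_eq_top_of_separatesPoints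
    (StarAlgebra.adjoin ℂ s) fun x y hxy => by
      obtain ⟨f, hf, hne⟩ := hsep x y hxy
      exact ⟨f, ⟨f, StarAlgebra.subset_adjoin ℂ s hf, rfl⟩, hne⟩
  rw [dense_iff_closure_eq, ← StarSubalgebra.topologicalClosure_coe, htop]
  rfl

end Commutator

/-! ### The triple of the tree -/

section TreeTriple

universe v

variable {V : Type v} {G : SimpleGraph V} (hG : G.IsTree) {ℓ : G.edgeSet → ℝ} (p : ℝ≥0∞) (u : V)
  [Fact (1 ≤ p)] [CompactSpace (TreeSpace hG ℓ p u)] (hℓ : ∀ e, 0 < ℓ e)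

theorem treeTriple_dirac : (treeTriple hG ℓ p u hℓ).dirac =
    diagonalOp (prodBasis fun e => intervalBasis (hℓ e))
      fun q => Real.pi * q.2 / ℓ q.1 + Real.pi / (2 * ℓ q.1) := by
  rw [← sumPMap_diagonalOp (fun e => intervalBasis (hℓ e))
    (fun e (k : ℤ) => Real.pi * k / ℓ e + Real.pi / (2 * ℓ e))]
  change sumPMap (fun e => _ +ᵥ intervalDirac (hℓ e)) = _
  congr 1
  funext e
  exact vadd_diagonalOp _ _ _

theorem treeTriple_rep (f : C(TreeSpace hG ℓ p u, ℂ)) : (treeTriple hG ℓ p u hℓ).rep f =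
    sumCLM (fun e => mulOp (hℓ e) (f.comp (edgeCurve hG ℓ p u e))) ‖f‖ (norm_nonneg f)
      fun e => NonUnitalStarAlgHom.norm_apply_le
        (curveTriple (hℓ e) (edgeCurve hG ℓ p u e)).rep f := rfl

/-- A function acting as zero vanishes on every edge, because on each summand multiplication by a
continuous function determines it; the edges are dense in the space. -/
theorem treeTriple_faithful : Function.Injective (treeTriple hG ℓ p u hℓ).rep := by
  rw [injective_iff_map_eq_zero]
  intro f hf
  rw [treeTriple_rep] at hf
  have hcomp : ∀ e, mulOp (hℓ e) (f.comp (edgeCurve hG ℓ p u e)) = 0 :=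
    eq_zero_of_sumCLM_eq_zero hf
  have hdense : Dense {x : TreeSpace hG ℓ p u |
      (x : lp (fun _ : G.edgeSet => ℝ) p) ∈ treePoints hG ℓ p u} := by
    intro x
    rw [closure_subtype]
    refine closure_mono (fun y hy => ?_) x.2
    exact ⟨⟨y, subset_closure hy⟩, hy, rfl⟩
  refine ContinuousMap.ext fun x => ?_
  refine congrFun (f.continuous.ext_on hdense continuous_const (g := fun _ => 0) ?_) x
  rintro y ⟨e, t, ht, hy⟩
  have : y = edgeCurve hG ℓ p u e ⟨t, ht⟩ := Subtype.ext hy.symm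
  rw [this]
  exact eq_zero_of_mulOp_eq_zero (hℓ e) (hcomp e) ⟨t, ht⟩

theorem lipschitz_of_treeTriple_commutator {f : C(TreeSpace hG ℓ p u, ℂ)}
    {B : lp (fun e : G.edgeSet => IntervalL2 (ℓ e)) 2 →L[ℂ] lp (fun e => IntervalL2 (ℓ e)) 2}
    (h : IsCommutator (treeTriple hG ℓ p u hℓ).dirac ((treeTriple hG ℓ p u hℓ).rep f) B)
    (e : G.edgeSet) (s t : Icc (0 : ℝ) (ℓ e)) :
    ‖f (edgeCurve hG ℓ p u e s) - f (edgeCurve hG ℓ p u e t)‖ ≤ |(s : ℝ) - t| * ‖B‖ := by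
  rw [treeTriple_dirac, treeTriple_rep] at h
  obtain ⟨B', hB', hm⟩ := exists_component_of_isCommutator (fun e => intervalBasis (hℓ e))
    (c := fun e (k : ℤ) => Real.pi * k / ℓ e + Real.pi / (2 * ℓ e)) h e
  refine (lipschitz_of_commutator (hℓ e) (f.comp (edgeCurve hG ℓ p u e)) (B := B')
    (fun n k => ?_) s t).trans (by gcongr)
  rw [hm]
  push_cast
  ring

theorem norm_sub_le_of_isCurve {f : C(TreeSpace hG ℓ p u, ℂ)}
    {B : lp (fun e : G.edgeSet => IntervalL2 (ℓ e)) 2 →L[ℂ] lp (fun e => IntervalL2 (ℓ e)) 2}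
    (h : IsCommutator (treeTriple hG ℓ p u hℓ).dirac ((treeTriple hG ℓ p u hℓ).rep f) B)
    (hB : ‖B‖ ≤ 1) {x y : TreeSpace hG ℓ p u} {L : ℝ}
    (hc : IsCurve (fun e => edgeCurve hG ℓ p u e) x y L) : ‖f x - f y‖ ≤ L := by
  induction hc with
  | nil x => simp
  | cons e s t y L hc ih =>
    have h1 := lipschitz_of_treeTriple_commutator hG p u hℓ h e s t
    have h2 : |(s : ℝ) - t| * ‖B‖ ≤ |(s : ℝ) - t| := mul_le_of_le_one_right (abs_nonneg _) hB
    have h3 := norm_sub_le_norm_sub_add_norm_sub (f (edgeCurve hG ℓ p u e s))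
      (f (edgeCurve hG ℓ p u e t)) (f y)
    linarith

/-- The function `x ↦ ∑ ε e x_e`, the sum ranging over finitely many edges. -/
def coordinateSum (F : Finset G.edgeSet) (ε : G.edgeSet → ℝ) : C(TreeSpace hG ℓ p u, ℂ) where
  toFun x := ((∑ e ∈ F, ε e * x.1 e : ℝ) : ℂ)
  continuous_toFun := by
    refine Complex.continuous_ofReal.comp (continuous_finsetSum _ fun e _ => ?_)
    exact continuous_const.mul
      ((lp.evalCLM ℝ (fun _ : G.edgeSet => ℝ) p e).continuous.comp continuous_subtype_val)

/-- Along an edge `e` only the coordinate of `e` moves, so the function is affine of slope `ε e` or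
`0`. The norm of the direct sum is governed by the worst block, not by the number of edges in `F`.
-/
theorem exists_commutator_coordinateSum (F : Finset G.edgeSet) {ε : G.edgeSet → ℝ}
    (hε : ∀ e, |ε e| ≤ 1) : ∃ B, IsCommutator (treeTriple hG ℓ p u hℓ).dirac
      ((treeTriple hG ℓ p u hℓ).rep (coordinateSum hG p u F ε)) B ∧ ‖B‖ ≤ 1 := by
  classical
  have haff : ∀ (e : G.edgeSet) (t : Icc (0 : ℝ) (ℓ e)),
      (coordinateSum hG p u F ε).comp (edgeCurve hG ℓ p u e) t =
        ((∑ e' ∈ F, ε e' * vertexPoint hG ℓ p u (nearEnd G u e) e' : ℝ) : ℂ) +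
          ((if e ∈ F then ε e else 0 : ℝ) : ℂ) * ((t : ℝ) : ℂ) := by
    intro e t
    change ((∑ e' ∈ F, ε e' * edgePoint hG ℓ p u e t e' : ℝ) : ℂ) = _
    rw [← Complex.ofReal_mul, ← Complex.ofReal_add]
    congr 1
    have : ∀ e', ε e' * edgePoint hG ℓ p u e t e' =
        ε e' * vertexPoint hG ℓ p u (nearEnd G u e) e' + if e' = e then ε e * t else 0 := by
      intro e'
      rw [edgePoint_apply]
      split_ifs with h
      · rw [h, vertexPoint_nearEnd_apply_self, mul_zero, zero_add]
      · rw [add_zero]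
    simp only [this, Finset.sum_add_distrib, Finset.sum_ite_eq', ite_mul, zero_mul]
  choose B hB hm using fun e => exists_commutator_of_affine (hℓ e)
    ((coordinateSum hG p u F ε).comp (edgeCurve hG ℓ p u e)) _
    (ε := if e ∈ F then ε e else 0) (by split_ifs; exacts [hε e, by simp]) (haff e)
  refine ⟨sumCLM B 1 zero_le_one hB, ?_, norm_sumCLM_le _ _ _ _⟩
  rw [treeTriple_dirac, treeTriple_rep]
  refine isCommutator_prodBasis (fun e => intervalBasis (hℓ e))
    (c := fun e (k : ℤ) => Real.pi * k / ℓ e + Real.pi / (2 * ℓ e)) fun e n k => ?_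
  rw [hm]
  push_cast
  ring

theorem dense_treeTriple_boundedCommutator : Dense {f : C(TreeSpace hG ℓ p u, ℂ) |
    ∃ B, IsCommutator (treeTriple hG ℓ p u hℓ).dirac ((treeTriple hG ℓ p u hℓ).rep f) B} := by
  refine dense_boundedCommutator_of_separatesPoints _
    (range fun e : G.edgeSet => coordinateSum hG p u {e} fun _ => 1) ?_ ?_ ?_
  · rintro _ ⟨e, rfl⟩
    ext x
    exact Complex.conj_ofReal _
  · rintro _ ⟨e, rfl⟩
    obtain ⟨B, hB, -⟩ := exists_commutator_coordinateSum hG p u hℓ {e} (ε := fun _ => 1) (by simp)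
    exact ⟨B, hB⟩
  · intro x y hxy
    by_contra! h
    refine hxy (Subtype.ext (lp.ext (funext fun e => ?_)))
    have := h _ ⟨e, rfl⟩
    simpa [coordinateSum] using this

theorem treeTriple_inducedDist [Nontrivial V] {x y : TreeSpace hG ℓ p u}
    (hx : (x : lp (fun _ : G.edgeSet => ℝ) p) ∈ treePoints hG ℓ p u)
    (hy : (y : lp (fun _ : G.edgeSet => ℝ) p) ∈ treePoints hG ℓ p u) :
    (treeTriple hG ℓ p u hℓ).inducedDist x y = geoDist (fun e => edgeCurve hG ℓ p u e) x y := by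
  refine le_antisymm ?_ ?_
  · refine iSup₂_le fun f ⟨B, hB, hn⟩ => le_iInf₂ fun L hL => ENNReal.ofReal_le_ofReal ?_
    exact norm_sub_le_of_isCurve hG p u hℓ hB hn hL
  · obtain ⟨L, hc, hs⟩ := joinedByGeodesic_of_mem_treePoints hG p u hℓ hx hy
    refine (iInf₂_le L hc).trans ?_
    -- For `p > 1` the sum over all edges need not converge on the whole space, so only its finite
    -- partial sums are test functions, and the bound passes to the limit.
    refine le_of_tendsto ((ENNReal.continuous_ofReal.tendsto L).comp hs)
      (Filter.Eventually.of_forall fun F => ?_)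
    let ε : G.edgeSet → ℝ := fun e => SignType.sign (x.1 e - y.1 e)
    have hε : ∀ e, |ε e| ≤ 1 := fun e => by
      rcases lt_trichotomy (x.1 e - y.1 e) 0 with h | h | h <;> simp [ε, h]
    refine le_trans (le_of_eq ?_)
      (le_iSup₂_of_le (coordinateSum hG p u F ε) (exists_commutator_coordinateSum hG p u hℓ F hε)
        le_rfl)
    have e1 : coordinateSum hG p u F ε x - coordinateSum hG p u F ε y =
        ((∑ e ∈ F, |x.1 e - y.1 e| : ℝ) : ℂ) := by
      change ((∑ e ∈ F, ε e * x.1 e : ℝ) : ℂ) - ((∑ e ∈ F, ε e * y.1 e : ℝ) : ℂ) = _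
      rw [← Complex.ofReal_sub, ← Finset.sum_sub_distrib]
      congr 1
      refine Finset.sum_congr rfl fun e _ => ?_
      rw [← mul_sub]
      exact sign_mul_self _
    rw [e1, Complex.norm_real, Real.norm_of_nonneg (Finset.sum_nonneg fun _ _ => abs_nonneg _)]
    rfl

theorem treeTriple_isSpectralTriple {r : ℝ} (hr : 0 < r) (hsum : Summable fun e => ℓ e ^ r) :
    (treeTriple hG ℓ p u hℓ).IsSpectralTriple where
  selfAdjoint := by
    rw [treeTriple_dirac]
    exact ⟨dense_diagonalOp_domain _ _, isSelfAdjoint_diagonalOp _ _⟩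
  dense_boundedCommutator := dense_treeTriple_boundedCommutator hG p u hℓ
  compact := by
    rw [treeTriple_dirac]
    obtain ⟨R, hR, hR'⟩ := exists_isInvOneAddSq (prodBasis fun e => intervalBasis (hℓ e))
      fun q => Real.pi * q.2 / ℓ q.1 + Real.pi / (2 * ℓ q.1)
    exact ⟨R, hR, isCompactOperator_of_repr _ hR' (tendsto_inv_one_add_sq hℓ hr hsum)⟩
  faithful := treeTriple_faithful hG p u hℓ

theorem treeTriple_isSummable_iff {s : ℝ} : (treeTriple hG ℓ p u hℓ).IsSummable s ↔
    0 < s ∧ Summable fun q : G.edgeSet × ℤ =>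
      (1 + (Real.pi * q.2 / ℓ q.1 + Real.pi / (2 * ℓ q.1)) ^ 2) ^ (-(s / 2)) := by
  unfold Triple.IsSummable
  refine and_congr_right fun hs => ?_
  rw [treeTriple_dirac]
  exact summable_diagonal_iff _ _ hs

end TreeTriple

end TreeTriple

theorem theorem7p10 {V : Type*} [Infinite V] (G : SimpleGraph V) (hG : G.IsTree)
    (ℓ : G.edgeSet → ℝ) (hℓ : ∀ e, 0 < ℓ e)
    (p : ℝ≥0∞) [Fact (1 ≤ p)] (hp : p ≠ ∞) (hsum : Summable fun e => ℓ e ^ p.toReal) (u : V) :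
    ∃ _ : CompactSpace (TreeTriple.TreeSpace hG ℓ p u),
      (TreeTriple.treeTriple hG ℓ p u hℓ).IsSpectralTriple ∧
      (∀ s : ℝ, (TreeTriple.treeTriple hG ℓ p u hℓ).IsSummable s → 1 < s) ∧
      (∀ s : ℝ, 1 < s →
        ((TreeTriple.treeTriple hG ℓ p u hℓ).IsSummable s ↔ Summable fun e => ℓ e ^ s)) ∧
      ∀ x y : TreeTriple.TreeSpace hG ℓ p u,
        (x : lp (fun _ : G.edgeSet => ℝ) p) ∈ TreeTriple.treePoints hG ℓ p u →
        (y : lp (fun _ : G.edgeSet => ℝ) p) ∈ TreeTriple.treePoints hG ℓ p u →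
        (TreeTriple.treeTriple hG ℓ p u hℓ).inducedDist x y =
          TreeTriple.geoDist (fun e => TreeTriple.edgeCurve hG ℓ p u e) x y := by
  have hp0 : 0 < p.toReal := ENNReal.toReal_pos (zero_lt_one.trans_le Fact.out).ne' hp
  obtain ⟨M, -, hM⟩ := TreeTriple.exists_forall_le_of_summable_rpow hℓ hp0 hsum
  refine ⟨TreeTriple.compactSpace_treeSpace hG p u hℓ hp hsum, ?_⟩
  have := TreeTriple.compactSpace_treeSpace hG p u hℓ hp hsum
  refine ⟨TreeTriple.treeTriple_isSpectralTriple hG p u hℓ hp0 hsum, fun s h => ?_,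
    fun s hs => ?_, fun x y hx hy => TreeTriple.treeTriple_inducedDist hG p u hℓ hx hy⟩
  · rw [TreeTriple.treeTriple_isSummable_iff] at h
    obtain ⟨v, hv⟩ := hG.connected.preconnected.exists_adj_of_nontrivial u
    -- The eigenvalues of any single edge already force `1 < s`.
    let e : G.edgeSet := ⟨s(u, v), hv⟩
    have hinj : Function.Injective fun k : ℤ => (e, k) := fun a b h => congrArg Prod.snd h
    have h2 := h.2.comp_injective hinj
    simp only [Function.comp_def] at h2
    exact TreeTriple.one_lt_of_summable_eigenvalues (hℓ e) h.1 h2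
  · rw [TreeTriple.treeTriple_isSummable_iff]
    refine ⟨fun h => ?_, fun h => ⟨by linarith, TreeTriple.summable_eigenvalues hℓ hs h⟩⟩
    have hinj : Function.Injective fun e : G.edgeSet => (e, (0 : ℤ)) :=
      fun a b h => congrArg Prod.fst h
    have h2 := h.2.comp_injective hinj
    simp only [Function.comp_def] at h2
    exact TreeTriple.summable_of_summable_eigenvalues hℓ hM h.1 h2
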